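/- A coloring $\chi=(\mathfrak B,\mathfrak W)$ is a partition of the plane $\mathbb{R}^2$ into two sets $\mathfrak B$ (black points) and $\mathfrak W$ (white points); its boundary is the common topological boundary of $\mathfrak B$ and $\mathfrak W$. The coloring $\chi$ is called polygonal if (1) each of $\mathfrak B$ and $\mathfrak W$ is contained in the closure of its interior; (2) the boundary of $\chi$ is a union of straight line segments (bounded segments, half-lines or lines, each with more than one point), any two of which may intersect only at common endpoints; and (3) every bounded region of the plane is intersected by only finitely many of these segments. A set of points is monochromatic if it is contained in $\mathfrak B$ or in $\mathfrak W$. A copy of a set of points is a set obtained from it by translations and rotations of the plane (reflections are not allowed). Theorem. Let $X,Y,Z$ be three distinct points of the plane (possibly collinear) whose three mutual distances are not all equal, and let $\chi$ be a polygonal coloring. Then there is a monochromatic copy $\{X',Y',Z'\}$ of $\{X,Y,Z\}$ such that none of the three points $X',Y',Z'$ belongs to the boundary of $\chi$. -/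

import Mathlib

/-- The Euclidean plane `ℝ²`, identified with `ℂ` (the norm of `ℂ` is the Euclidean one). -/
abbrev Plane : Type := ℂ

/-- A coloring: a partition of the plane into a set of black and a set of white points. -/
structure PlaneColoring where
  black : Set Plane
  white : Set Plane
  isCompl : IsCompl black white

namespace PlaneColoring

/-- The boundary of a coloring: the common topological boundary of its two classes
(see `boundary_eq_frontier_white`). -/
def boundary (χ : PlaneColoring) : Set Plane := frontier χ.black

theorem boundary_eq_frontier_white (χ : PlaneColoring) : χ.boundary = frontier χ.white := by
  rw [boundary, ← χ.isCompl.compl_eq, frontier_compl]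

/-- A set of points is monochromatic if all its points are black or all its points are white. -/
def Monochromatic (χ : PlaneColoring) (T : Set Plane) : Prop :=
  T ⊆ χ.black ∨ T ⊆ χ.white

end PlaneColoring

/-- `T'` is a copy of `T`: it is obtained from `T` by translations and rotations, that is, by an
orientation-preserving isometry `z ↦ u * z + v` with `‖u‖ = 1`. -/
def IsCopy (T' T : Set Plane) : Prop :=
  ∃ u v : Plane, ‖u‖ = 1 ∧ T' = (fun z => u * z + v) '' T

/-- Straight line segments (with more than one point), possibly unbounded: a bounded segment with
endpoints `a` and `b`, a half-line from `a` with direction `d`, or a line through `a` with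
direction `d`. -/
inductive StraightSegment : Type
  | bounded (a b : Plane) (h : a ≠ b) : StraightSegment
  | halfLine (a d : Plane) (h : d ≠ 0) : StraightSegment
  | line (a d : Plane) (h : d ≠ 0) : StraightSegment

namespace StraightSegment

/-- The set of points of a (closed) straight line segment. -/
def carrier : StraightSegment → Set Plane
  | bounded a b _ => segment ℝ a b
  | halfLine a d _ => {z | ∃ t : ℝ, 0 ≤ t ∧ z = a + (t : ℂ) * d}
  | line a d _ => {z | ∃ t : ℝ, z = a + (t : ℂ) * d}

/-- The endpoints of a segment: two, one or none, according to its kind. -/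
def endpoints : StraightSegment → Set Plane
  | bounded a b _ => {a, b}
  | halfLine a _ _ => {a}
  | line _ _ _ => ∅

end StraightSegment

/-- A coloring is polygonal if each color class is contained in the closure of its interior, and
its boundary is the union of a family `S` of straight line segments, two of which meet at most at
points that are endpoints of both, such that every bounded region meets only finitely many of them.

Nothing is required of the angle between two segments of `S` that meet at a vertex: two segments
that form a straight angle can be merged into one, so excluding this would only normalize `S`,
and would not change the class of colorings. -/
def PlaneColoring.IsPolygonal (χ : PlaneColoring) : Prop :=
  χ.black ⊆ closure (interior χ.black) ∧
  χ.white ⊆ closure (interior χ.white) ∧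
  ∃ S : Set StraightSegment,
    χ.boundary = ⋃ s ∈ S, s.carrier ∧
    (∀ s ∈ S, ∀ t ∈ S, s ≠ t → s.carrier ∩ t.carrier ⊆ s.endpoints ∩ t.endpoints) ∧
    ∀ R : Set Plane, Bornology.IsBounded R → {s ∈ S | (s.carrier ∩ R).Nonempty}.Finite

/-- The three points `X`, `Y`, `Z` form a triangle: they are distinct. Collinear triples are
included, as degenerate triangles. -/
def IsTriangle (X Y Z : Plane) : Prop := X ≠ Y ∧ Y ≠ Z ∧ Z ≠ X

/-- All three sides of `XYZ` have the same length. -/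
def IsEquilateral (X Y Z : Plane) : Prop := dist X Y = dist Y Z ∧ dist Y Z = dist Z X

/-! Suppose no copy of the triangle has all three vertices inside one color. A chain of forced
colors (`avoidsEquilateral`) then excludes monochromatic equilateral triangles whose side is any of
the three distances. Two of these distances differ, so it is enough to show that an interface
between two colors cannot avoid equilateral triangles of two sizes `a < b` (`false_of_avoids`).

Fix one avoided side `r` and a boundary point `P`. The color changes on the circle of radius `r`
about `P` are invariant under rotation by π/3, because `P` can be pushed into either color
(`om_mul_mem_transitions`). Sliding `P` and a color change `P + w` along the boundary while keeping
their distance `r` forces the boundary to look alike at both points: two rays with the same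
directions, one on each side of the normal of `w` (`exists_dirs_eq`). Hence color changes persist as
vectors along the boundary. Each boundary point lies on a bi-infinite curve in the boundary, which
is a graph over some `w`, is invariant under a translation `v` of length `r`, and whose rays stay
within angle π/6 of the line of `v` (`exists_isPeriodicCurve`).

For `r = b`, the translates of this curve inside the boundary are measured by their height `cross v
u`. A color change of length `a` yields a translate of small positive height, and
`exists_transition_of_translation` replaces it by a color change of length `b` of equal height.
There are finitely many of these, so one has least height; rotating it by π/3 or -π/3 and
subtracting `om * v` gives a smaller positive height, a contradiction. -/

open Filter Topology

/-! ### Inner product, oriented area and the sixth root of unity -/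

/-- The real inner product of two complex numbers. -/
def dot (w z : ℂ) : ℝ := w.re * z.re + w.im * z.im

/-- The oriented area of the parallelogram spanned by two complex numbers. -/
def cross (w z : ℂ) : ℝ := w.re * z.im - w.im * z.re

/-- The primitive sixth root of unity `exp (π i / 3)`. -/
noncomputable def om : ℂ := ⟨1 / 2, √3 / 2⟩

@[simp] theorem om_re : om.re = 1 / 2 := rfl

@[simp] theorem om_im : om.im = √3 / 2 := rfl

theorem om_sq : om * om = om - 1 := by
  have h : √3 * √3 = 3 := Real.mul_self_sqrt (by norm_num)
  apply Complex.ext <;> simp <;> nlinarith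

theorem om_cube : om * (om * om) = -1 := by
  rw [om_sq, mul_sub, om_sq]; ring

theorem norm_om : ‖om‖ = 1 := by
  have h : √3 * √3 = 3 := Real.mul_self_sqrt (by norm_num)
  have : ‖om‖ ^ 2 = 1 := by
    rw [Complex.sq_norm, Complex.normSq_apply]; simp; nlinarith
  nlinarith [norm_nonneg om, sq_nonneg (‖om‖ - 1)]

theorem dot_add (w y z : ℂ) : dot w (y + z) = dot w y + dot w z := by simp [dot]; ring
theorem dot_sub (w y z : ℂ) : dot w (y - z) = dot w y - dot w z := by simp [dot]; ring
theorem dot_neg (w z : ℂ) : dot w (-z) = -dot w z := by simp [dot]; ring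
theorem neg_dot (w z : ℂ) : dot (-w) z = -dot w z := by simp [dot]; ring
theorem dot_real_mul (w z : ℂ) (t : ℝ) : dot w (t * z) = t * dot w z := by simp [dot]; ring
theorem dot_comm (w z : ℂ) : dot w z = dot z w := by simp [dot]; ring
theorem dot_self (w : ℂ) : dot w w = ‖w‖ ^ 2 := by
  rw [Complex.sq_norm, Complex.normSq_apply]; rfl
theorem cross_real_mul (w z : ℂ) (t : ℝ) : cross w (t * z) = t * cross w z := by
  simp [cross]; ring
theorem dot_zero (w : ℂ) : dot w 0 = 0 := by simp [dot]
theorem cross_zero (w : ℂ) : cross w 0 = 0 := by simp [cross]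

theorem continuous_dot (w : ℂ) : Continuous (dot w) := by unfold dot; fun_prop
theorem continuous_cross (w : ℂ) : Continuous (cross w) := by unfold cross; fun_prop

theorem dot_om_mul (w e : ℂ) : dot (om * w) e = dot w e / 2 + √3 / 2 * cross w e := by
  simp [dot, cross]; ring

theorem norm_sq_add (w v : ℂ) : ‖w + v‖ ^ 2 = ‖w‖ ^ 2 + 2 * dot w v + ‖v‖ ^ 2 := by
  simp only [← dot_self]; simp [dot]; ring

theorem dot_sq_add_cross_sq (w e : ℂ) : dot w e ^ 2 + cross w e ^ 2 = ‖w‖ ^ 2 * ‖e‖ ^ 2 := by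
  simp only [← dot_self]; simp [dot, cross]; ring

theorem cross_ne_zero_of_dot_eq_zero {w e : ℂ} (hw : w ≠ 0) (he : e ≠ 0) (h : dot w e = 0) :
    cross w e ≠ 0 := by
  intro h'
  have := dot_sq_add_cross_sq w e
  rw [h, h'] at this
  have h1 : 0 < ‖w‖ := norm_pos_iff.2 hw
  have h2 : 0 < ‖e‖ := norm_pos_iff.2 he
  have : 0 < ‖w‖ ^ 2 * ‖e‖ ^ 2 := by positivity
  linarith

theorem eq_or_eq_neg_of_cross_eq_zero {e g : ℂ} (he : ‖e‖ = 1) (hg : ‖g‖ = 1)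
    (h : cross e g = 0) : g = e ∨ g = -e := by
  have h1 := dot_sq_add_cross_sq e g
  rw [h, he, hg] at h1
  have h2 : (dot e g - 1) * (dot e g + 1) = 0 := by nlinarith
  rcases mul_eq_zero.1 h2 with h3 | h3
  · left
    have : ‖g + (-e)‖ ^ 2 = 0 := by
      rw [norm_sq_add, norm_neg, dot_neg, dot_comm, he, hg]; linarith
    have h4 := norm_eq_zero.1 (pow_eq_zero_iff (two_ne_zero) |>.1 this)
    linear_combination h4
  · right
    have : ‖g + e‖ ^ 2 = 0 := by
      rw [norm_sq_add, dot_comm, he, hg]; linarith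
    have h4 := norm_eq_zero.1 (pow_eq_zero_iff (two_ne_zero) |>.1 this)
    linear_combination h4

theorem convex_lt_dot (a : ℂ) (c : ℝ) : Convex ℝ {z : ℂ | c < dot a z} :=
  convex_halfSpace_gt ⟨fun x y => dot_add a x y, fun t x => by simpa using dot_real_mul a x t⟩ c

theorem convex_le_dot (a : ℂ) (c : ℝ) : Convex ℝ {z : ℂ | c ≤ dot a z} :=
  convex_halfSpace_ge ⟨fun x y => dot_add a x y, fun t x => by simpa using dot_real_mul a x t⟩ c

/-! ### Interfaces between two open color classes -/

/-- The unit directions of the germs of rays at `P` that are contained in `D`. -/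
def dirs (D : Set ℂ) (P : ℂ) : Set ℂ :=
  {e | ‖e‖ = 1 ∧ ∃ ε > 0, ∀ t : ℝ, 0 < t → t < ε → P + t * e ∈ D}

/-- `D` is a locally conic set, each of whose points is in the closure of both of the open sets
`U` and `V` into which its complement is divided. -/
structure PolygonalInterface (D U V : Set ℂ) : Prop where
  isOpen_left : IsOpen U
  isOpen_right : IsOpen V
  disjoint : Disjoint U V
  union_eq : U ∪ V = Dᶜ
  subset_closure_left : D ⊆ closure U
  subset_closure_right : D ⊆ closure V
  dirs_finite : ∀ P, (dirs D P).Finite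
  dirs_nonempty : ∀ P ∈ D, (dirs D P).Nonempty
  conic : ∀ P, ∃ ε > 0, ∀ (e : ℂ) (t : ℝ), ‖e‖ = 1 → 0 < t → t < ε →
    (P + t * e ∈ D ↔ e ∈ dirs D P)
  sphere_finite : ∀ (P : ℂ) (r : ℝ), 0 < r → (D ∩ Metric.sphere P r).Finite

theorem exists_unit_mul {z P : ℂ} (h : z ≠ P) :
    ∃ e : ℂ, ‖e‖ = 1 ∧ z = P + (‖z - P‖ : ℝ) * e := by
  have h0 : (‖z - P‖ : ℂ) ≠ 0 := by
    simpa [sub_eq_zero] using h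
  refine ⟨(z - P) / (‖z - P‖ : ℝ), ?_, ?_⟩
  · rw [norm_div, Complex.norm_real, norm_norm, div_self]
    simpa [sub_eq_zero] using h
  · rw [mul_div_cancel₀ _ h0]; ring

namespace PolygonalInterface

variable {D U V : Set ℂ}

theorem symm (hD : PolygonalInterface D U V) : PolygonalInterface D V U where
  isOpen_left := hD.isOpen_right
  isOpen_right := hD.isOpen_left
  disjoint := hD.disjoint.symm
  union_eq := by rw [Set.union_comm, hD.union_eq]
  subset_closure_left := hD.subset_closure_right
  subset_closure_right := hD.subset_closure_left
  dirs_finite := hD.dirs_finite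
  dirs_nonempty := hD.dirs_nonempty
  conic := hD.conic
  sphere_finite := hD.sphere_finite

theorem isClosed (hD : PolygonalInterface D U V) : IsClosed D := by
  rw [← isOpen_compl_iff, ← hD.union_eq]
  exact hD.isOpen_left.union hD.isOpen_right

theorem not_mem_left (hD : PolygonalInterface D U V) {z : ℂ} (hz : z ∈ D) : z ∉ U := fun h =>
  (hD.union_eq ▸ Set.mem_union_left V h : z ∈ Dᶜ) hz

theorem not_mem_right (hD : PolygonalInterface D U V) {z : ℂ} (hz : z ∈ D) : z ∉ V :=
  hD.symm.not_mem_left hz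

theorem mem_or_mem (hD : PolygonalInterface D U V) {z : ℂ} (hz : z ∉ D) : z ∈ U ∨ z ∈ V := by
  have : z ∈ Dᶜ := hz
  rwa [← hD.union_eq] at this

theorem not_mem_both (hD : PolygonalInterface D U V) {z : ℂ} (hU : z ∈ U) (hV : z ∈ V) : False :=
  Set.disjoint_left.1 hD.disjoint hU hV

theorem subset_or_subset (hD : PolygonalInterface D U V) {S : Set ℂ} (hS : IsPreconnected S)
    (h : ∀ z ∈ S, z ∉ D) : S ⊆ U ∨ S ⊆ V :=
  hS.subset_or_subset hD.isOpen_left hD.isOpen_right hD.disjoint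
    fun z hz => hD.mem_or_mem (h z hz)

/-- In a small disc around `P` the interface is a union of rays, and all points other than `P`
are smooth. -/
theorem exists_radius (hD : PolygonalInterface D U V) (P : ℂ) : ∃ ε > 0,
    (∀ (e : ℂ) (t : ℝ), ‖e‖ = 1 → 0 < t → t < ε → (P + t * e ∈ D ↔ e ∈ dirs D P)) ∧
    (∀ e ∈ dirs D P, ∀ t : ℝ, 0 < t → t < ε → dirs D (P + t * e) = {e, -e}) := by
  obtain ⟨ε, hε, h⟩ := hD.conic P
  refine ⟨ε, hε, h, fun e he t ht htε => ?_⟩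
  have he1 : ‖e‖ = 1 := he.1
  apply Set.eq_of_subset_of_subset
  · rintro g ⟨hg1, δ, hδ, hg⟩
    by_contra hne
    have hcr : cross e g ≠ 0 := fun h0 => hne (by
      simpa using eq_or_eq_neg_of_cross_eq_zero he1 hg1 h0)
    have hz : ∀ s : ℝ, 0 < s → t * e + s * g ≠ 0 := by
      intro s hs h0
      apply hcr
      have : cross e (t * e + s * g) = 0 := by rw [h0, cross_zero]
      have h2 : cross e (t * e + s * g) = s * cross e g := by simp [cross]; ring
      rw [h2] at this
      exact (mul_eq_zero.1 this).resolve_left hs.ne'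
    have hlim : Tendsto (fun s : ℝ => (t * e + s * g) / (‖t * e + s * g‖ : ℝ)) (𝓝[>] 0) (𝓝 e) := by
      have hc : ContinuousAt (fun s : ℝ => (t * e + s * g) / (‖t * e + s * g‖ : ℝ)) 0 := by
        apply ContinuousAt.div (by fun_prop) (by fun_prop)
        simp [he1, ht.ne']
      have h0 : (fun s : ℝ => (t * e + s * g) / (‖t * e + s * g‖ : ℝ)) 0 = e := by
        have : (t : ℂ) ≠ 0 := by exact_mod_cast ht.ne'
        simp [he1, abs_of_pos ht]
        field_simp
      have := hc.tendsto
      simp only [] at h0; rw [h0] at this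
      exact this.mono_left nhdsWithin_le_nhds
    -- Seen from `P`, the points `P + t * e + s * g` have directions in the finite set `dirs D P`
    -- that tend to `e`, so the direction equals `e` for small `s`. This contradicts `cross e g ≠
    -- 0`.
    have hfin : (dirs D P \ {e}).Finite := (hD.dirs_finite P).subset Set.sdiff_subset
    have hev : ∀ᶠ z in 𝓝 e, z ∉ dirs D P \ {e} :=
      hfin.isClosed.isOpen_compl.mem_nhds (by simp)
    have hnorm : ∀ᶠ s : ℝ in 𝓝[>] 0, ‖(t : ℂ) * e + s * g‖ < ε := by
      have hc : ContinuousAt (fun s : ℝ => ‖(t : ℂ) * e + s * g‖) 0 := by fun_prop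
      apply (hc.tendsto.mono_left nhdsWithin_le_nhds).eventually_lt_const
      simpa [he1, abs_of_pos ht] using htε
    have hpos : ∀ᶠ s : ℝ in 𝓝[>] 0, 0 < s := self_mem_nhdsWithin
    have hlt : ∀ᶠ s : ℝ in 𝓝[>] 0, s < δ := nhdsWithin_le_nhds (Iio_mem_nhds hδ)
    obtain ⟨s, h1, h2, h3, h4⟩ := ((hlim.eventually hev).and (hnorm.and (hpos.and hlt))).exists
    have h5 := hz s h3
    have h5' : ‖(t : ℂ) * e + s * g‖ ≠ 0 := norm_ne_zero_iff.2 h5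
    set u := (t * e + s * g) / (‖(t : ℂ) * e + s * g‖ : ℝ) with hu
    have hu1 : ‖u‖ = 1 := by
      rw [hu, norm_div, Complex.norm_real, norm_norm, div_self h5']
    have hmul : (‖(t : ℂ) * e + s * g‖ : ℝ) * u = t * e + s * g := by
      rw [hu, mul_div_cancel₀]; exact_mod_cast h5'
    have hmem : u ∈ dirs D P := by
      rw [← h u ‖(t : ℂ) * e + s * g‖ hu1 (norm_pos_iff.2 h5) h2, hmul, ← add_assoc]
      exact hg s h3 h4
    have hue : u = e := by
      by_contra hue
      exact h1 ⟨hmem, hue⟩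
    rw [hue] at hmul
    apply hcr
    have h6 : cross e (t * e + s * g) = s * cross e g := by simp [cross]; ring
    rw [← hmul, cross_real_mul] at h6
    have h7 : cross e e = 0 := by simp [cross]; ring
    rw [h7, mul_zero] at h6
    exact (mul_eq_zero.1 h6.symm).resolve_left h3.ne'
  · rintro g (rfl | hg)
    · refine ⟨he1, ε - t, by linarith, fun s hs hs' => ?_⟩
      have := (h g (t + s) he1 (by linarith) (by linarith)).2 he
      convert this using 1; push_cast; ring
    · rw [Set.mem_singleton_iff] at hg
      subst hg
      refine ⟨by simpa using he1, t, ht, fun s hs hs' => ?_⟩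
      have := (h e (t - s) he1 (by linarith) (by linarith)).2 he
      convert this using 1; push_cast; ring

/-- Points of the interface near `P` lie on the rays of the interface at `P`. -/
theorem exists_radius_mem (hD : PolygonalInterface D U V) (P : ℂ) : ∃ ε > 0,
    ∀ z ∈ D, ‖z - P‖ < ε → z = P ∨ ∃ e ∈ dirs D P, ∃ t : ℝ, 0 < t ∧ t < ε ∧ z = P + t * e ∧
      dirs D z = {e, -e} := by
  obtain ⟨ε, hε, h, h'⟩ := hD.exists_radius P
  refine ⟨ε, hε, fun z hz hzε => ?_⟩
  by_cases hzP : z = P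
  · exact Or.inl hzP
  · obtain ⟨e, he, hze⟩ := exists_unit_mul hzP
    have hpos : 0 < ‖z - P‖ := norm_pos_iff.2 (sub_ne_zero.2 hzP)
    have hed : e ∈ dirs D P := (h e _ he hpos hzε).1 (hze ▸ hz)
    exact Or.inr ⟨e, hed, _, hpos, hzε, hze, by rw [hze]; exact h' e hed _ hpos (hze ▸ hzε)⟩

theorem mem_of_dirs_nonempty (hD : PolygonalInterface D U V) {P e : ℂ} (he : e ∈ dirs D P) :
    P ∈ D := by
  obtain ⟨-, ε, hε, h⟩ := he
  have hlim : Tendsto (fun t : ℝ => P + t * e) (𝓝[>] 0) (𝓝 P) := by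
    have hc : ContinuousAt (fun t : ℝ => P + t * e) 0 := by fun_prop
    simpa using hc.tendsto.mono_left (nhdsWithin_le_nhds (s := Set.Ioi 0))
  refine hD.isClosed.mem_of_tendsto hlim ?_
  have hlt : ∀ᶠ s : ℝ in 𝓝[>] 0, s < ε := nhdsWithin_le_nhds (Iio_mem_nhds hε)
  filter_upwards [hlt, self_mem_nhdsWithin] with t h1 h2 using h t h2 h1

end PolygonalInterface

/-! ### Motion along a circle -/

/-- A rational parametrization of the unit circle without `-1`. -/
noncomputable def spin (τ : ℝ) : ℂ := ⟨(1 - τ ^ 2) / (1 + τ ^ 2), 2 * τ / (1 + τ ^ 2)⟩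

theorem norm_spin (τ : ℝ) : ‖spin τ‖ = 1 := by
  have h : ‖spin τ‖ ^ 2 = 1 := by
    rw [Complex.sq_norm, Complex.normSq_apply]
    simp only [spin]
    field_simp
    ring
  nlinarith [norm_nonneg (spin τ)]

theorem spin_injective : Function.Injective spin := by
  intro a b h
  have h1 := congrArg Complex.re h
  have h2 := congrArg Complex.im h
  simp only [spin] at h1 h2
  have ha : 0 < 1 + a ^ 2 := by positivity
  have hb : 0 < 1 + b ^ 2 := by positivity
  rw [div_eq_div_iff ha.ne' hb.ne'] at h1 h2
  have h3 : a ^ 2 = b ^ 2 := by nlinarith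
  rw [h3] at h2
  have := mul_right_cancel₀ hb.ne' h2
  linarith

theorem continuous_spin : Continuous spin := by
  have : spin = fun τ : ℝ => (((1 - τ ^ 2) / (1 + τ ^ 2) : ℝ) : ℂ)
      + ((2 * τ / (1 + τ ^ 2) : ℝ) : ℂ) * Complex.I := by
    funext τ; apply Complex.ext <;> simp [spin, -Complex.ofReal_div]
  rw [this]
  have h : ∀ τ : ℝ, 1 + τ ^ 2 ≠ 0 := fun τ => by positivity
  have h1 : Continuous fun τ : ℝ => (1 - τ ^ 2) / (1 + τ ^ 2) :=
    Continuous.div (by fun_prop) (by fun_prop) h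
  have h2 : Continuous fun τ : ℝ => 2 * τ / (1 + τ ^ 2) :=
    Continuous.div (by fun_prop) (by fun_prop) h
  exact (Complex.continuous_ofReal.comp h1).add
    ((Complex.continuous_ofReal.comp h2).mul continuous_const)

theorem spin_zero : spin 0 = 1 := by apply Complex.ext <;> simp [spin]

theorem tendsto_mul_spin (w : ℂ) : Tendsto (fun τ => w * spin τ) (𝓝 0) (𝓝 w) := by
  have := (continuous_spin.tendsto 0).const_mul w
  rwa [spin_zero, mul_one] at this

/-- The inward displacement along the circle is of order `τ ^ 2`, while the tangential one in
`cross_mul_spin_sub` is of order `τ`. This decides on which side of a transversal ray the circle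
runs. -/
theorem dot_mul_spin_sub (w : ℂ) (τ : ℝ) :
    dot w (w * spin τ - w) = -2 * τ ^ 2 / (1 + τ ^ 2) * ‖w‖ ^ 2 := by
  rw [← dot_self]
  have h : 1 + τ ^ 2 ≠ 0 := by positivity
  simp only [dot, spin, Complex.sub_re, Complex.sub_im, Complex.mul_re, Complex.mul_im]
  field_simp
  ring

theorem cross_mul_spin_sub (w : ℂ) (τ : ℝ) :
    cross w (w * spin τ - w) = 2 * τ / (1 + τ ^ 2) * ‖w‖ ^ 2 := by
  rw [← dot_self]
  have h : 1 + τ ^ 2 ≠ 0 := by positivity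
  simp only [dot, cross, spin, Complex.sub_re, Complex.sub_im, Complex.mul_re, Complex.mul_im]
  field_simp
  ring

/-! ### Color changes on circles about a boundary point -/

/-- The vectors `w` of length `r` such that both `U` and `V` occur arbitrarily close to `P + w` on
the circle with center `P` and radius `r`. -/
def transitions (U V : Set ℂ) (r : ℝ) (P : ℂ) : Set ℂ :=
  {w | ‖w‖ = r ∧ w ∈ closure {w' | ‖w'‖ = r ∧ P + w' ∈ U} ∧
    w ∈ closure {w' | ‖w'‖ = r ∧ P + w' ∈ V}}

/-- No equilateral triangle of side `r` has all its vertices in `U`. -/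
def AvoidsEquilateral (U : Set ℂ) (r : ℝ) : Prop :=
  ∀ P w : ℂ, ‖w‖ = r → P ∈ U → P + w ∈ U → P + om * w ∈ U → False

namespace PolygonalInterface

variable {D U V : Set ℂ} {r : ℝ} {P w : ℂ}

theorem mem_of_mem_transitions (hD : PolygonalInterface D U V) (hw : w ∈ transitions U V r P) :
    P + w ∈ D := by
  have hc : Continuous fun z : ℂ => P + z := by fun_prop
  have key : ∀ W : Set ℂ, w ∈ closure {w' | ‖w'‖ = r ∧ P + w' ∈ W} → P + w ∈ closure W := by
    intro W h
    exact map_mem_closure hc h fun z hz => hz.2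
  by_contra h
  rcases hD.mem_or_mem h with h1 | h1
  · obtain ⟨z, hz1, hz2⟩ := mem_closure_iff.1 (key V hw.2.2) U hD.isOpen_left h1
    exact hD.not_mem_both hz1 hz2
  · obtain ⟨z, hz1, hz2⟩ := mem_closure_iff.1 (key U hw.2.1) V hD.isOpen_right h1
    exact hD.not_mem_both hz2 hz1

theorem finite_transitions (hD : PolygonalInterface D U V) (hr : 0 < r) (P : ℂ) :
    (transitions U V r P).Finite := by
  have h := (hD.sphere_finite P r hr).image fun z => z - P
  refine h.subset fun w hw => ⟨P + w, ⟨hD.mem_of_mem_transitions hw, ?_⟩, by simp⟩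
  simpa using hw.1

/-- Points of a circle off a finite set are dense. -/
theorem eventually_not_mem (hD : PolygonalInterface D U V) (hr : 0 < r) (hw : ‖w‖ = r) (P : ℂ) :
    ∀ᶠ τ in 𝓝[≠] (0 : ℝ), P + w * spin τ ∉ D := by
  have hw0 : w ≠ 0 := norm_pos_iff.1 (hw ▸ hr)
  have hinj : Function.Injective fun τ : ℝ => P + w * spin τ := fun a b h =>
    spin_injective (mul_left_cancel₀ hw0 (add_left_cancel h))
  have hfin : ((fun τ : ℝ => P + w * spin τ) ⁻¹' (D ∩ Metric.sphere P r)).Finite :=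
    (hD.sphere_finite P r hr).preimage hinj.injOn
  have h0 : ∀ᶠ τ in 𝓝 (0 : ℝ),
      τ ∉ (fun τ : ℝ => P + w * spin τ) ⁻¹' (D ∩ Metric.sphere P r) \ {0} :=
    (hfin.subset Set.sdiff_subset).isClosed.isOpen_compl.mem_nhds (by simp)
  filter_upwards [nhdsWithin_le_nhds h0, self_mem_nhdsWithin] with τ h1 h2 h3
  exact h1 ⟨⟨h3, by simp [norm_spin, hw]⟩, h2⟩

/-- A boundary point counts as a vertex of either color: the two other vertices stay in the open set
`U` while `P` is moved slightly into `U`. -/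
theorem not_mem_of_avoids (hD : PolygonalInterface D U V) (hU : AvoidsEquilateral U r)
    (hP : P ∈ D) (hw : ‖w‖ = r) (h1 : P + w ∈ U) (h2 : P + om * w ∈ U) : False := by
  have hopen : IsOpen {Q : ℂ | Q + w ∈ U ∧ Q + om * w ∈ U} :=
    (hD.isOpen_left.preimage (by fun_prop)).inter (hD.isOpen_left.preimage (by fun_prop))
  obtain ⟨Q, hQ, hQU⟩ := mem_closure_iff.1 (hD.subset_closure_left hP) _ hopen ⟨h1, h2⟩
  exact hU Q w hw hQU hQ.1 hQ.2

/-- Where the circle about `P` is in `U`, the point rotated by π/3 cannot be in `U`. As the circle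
meets `D` in a finite set only, the rotated point is a limit of points of `V` on the circle. -/
theorem om_mul_mem_closure (hD : PolygonalInterface D U V) (hr : 0 < r)
    (hU : AvoidsEquilateral U r) (hP : P ∈ D)
    (hw : w ∈ closure {w' | ‖w'‖ = r ∧ P + w' ∈ U}) :
    om * w ∈ closure {w' | ‖w'‖ = r ∧ P + w' ∈ V} := by
  have key : ∀ z ∈ {w' | ‖w'‖ = r ∧ P + w' ∈ U},
      om * z ∈ closure {w' | ‖w'‖ = r ∧ P + w' ∈ V} := by
    rintro z ⟨hz, hzU⟩
    have hz' : ‖om * z‖ = r := by rw [norm_mul, norm_om, one_mul, hz]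
    refine mem_closure_of_tendsto ((tendsto_mul_spin (om * z)).mono_left
      (nhdsWithin_le_nhds (s := {0}ᶜ))) ?_
    have hev : ∀ᶠ τ in 𝓝 (0 : ℝ), P + z * spin τ ∈ U := by
      have := (tendsto_mul_spin z).const_add P
      exact this.eventually (hD.isOpen_left.mem_nhds hzU)
    filter_upwards [hD.eventually_not_mem hr hz' P, nhdsWithin_le_nhds hev] with τ h1 h2
    refine ⟨by simp [norm_spin, norm_om, hz], (hD.mem_or_mem h1).resolve_left fun h3 => ?_⟩
    exact hD.not_mem_of_avoids hU hP (w := z * spin τ) (by simp [norm_spin, hz]) h2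
      (by rwa [← mul_assoc])
  have hc : Continuous fun z : ℂ => om * z := by fun_prop
  have := map_mem_closure (t := closure {w' | ‖w'‖ = r ∧ P + w' ∈ V}) hc hw key
  rwa [closure_closure] at this

theorem om_mul_mem_transitions (hD : PolygonalInterface D U V) (hr : 0 < r)
    (hU : AvoidsEquilateral U r) (hV : AvoidsEquilateral V r) (hP : P ∈ D)
    (hw : w ∈ transitions U V r P) : om * w ∈ transitions U V r P :=
  ⟨by rw [norm_mul, norm_om, one_mul, hw.1], hD.symm.om_mul_mem_closure hr hV hP hw.2.2,
    hD.om_mul_mem_closure hr hU hP hw.2.1⟩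

theorem neg_mem_transitions (hD : PolygonalInterface D U V) (hr : 0 < r)
    (hU : AvoidsEquilateral U r) (hV : AvoidsEquilateral V r) (hP : P ∈ D)
    (hw : w ∈ transitions U V r P) : -w ∈ transitions U V r P := by
  have h := hD.om_mul_mem_transitions hr hU hV hP (hD.om_mul_mem_transitions hr hU hV hP
    (hD.om_mul_mem_transitions hr hU hV hP hw))
  have h2 : om * (om * (om * w)) = -w := by linear_combination w * om_cube
  rwa [h2] at h

/-- Two points of the circle that are π/3 apart and off `D` have different colors, so both colors
occur; the circle is connected, hence the closures of its two parts meet. -/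
theorem transitions_nonempty (hD : PolygonalInterface D U V) (hr : 0 < r)
    (hU : AvoidsEquilateral U r) (hV : AvoidsEquilateral V r) (hP : P ∈ D) :
    (transitions U V r P).Nonempty := by
  have hpc : IsPreconnected (Metric.sphere (0 : ℂ) r) :=
    isPreconnected_sphere (by simp [Complex.rank_real_complex]) 0 r
  have hr' : ‖(r : ℂ)‖ = r := by simp [abs_of_pos hr]
  have hom : ‖om * (r : ℂ)‖ = r := by rw [norm_mul, norm_om, one_mul, hr']
  obtain ⟨τ, h1, h2⟩ := ((hD.eventually_not_mem hr hr' P).and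
    (hD.eventually_not_mem hr hom P)).exists
  have hn : ‖(r : ℂ) * spin τ‖ = r := by simp [norm_spin, abs_of_pos hr]
  have hn' : ‖om * (r : ℂ) * spin τ‖ = r := by simp [norm_spin, norm_om, abs_of_pos hr]
  have hne : (Metric.sphere (0 : ℂ) r ∩ closure {w' | ‖w'‖ = r ∧ P + w' ∈ U}).Nonempty ∧
      (Metric.sphere (0 : ℂ) r ∩ closure {w' | ‖w'‖ = r ∧ P + w' ∈ V}).Nonempty := by
    rcases hD.mem_or_mem h1 with h3 | h3
    · have h4 : P + om * r * spin τ ∈ V := (hD.mem_or_mem h2).resolve_left fun h4 =>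
        hD.not_mem_of_avoids hU hP hn h3 (by rwa [← mul_assoc])
      exact ⟨⟨_, by simpa using hn, subset_closure ⟨hn, h3⟩⟩,
        ⟨_, by simpa using hn', subset_closure ⟨hn', h4⟩⟩⟩
    · have h4 : P + om * r * spin τ ∈ U := (hD.mem_or_mem h2).resolve_right fun h4 =>
        hD.symm.not_mem_of_avoids hV hP hn h3 (by rwa [← mul_assoc])
      exact ⟨⟨_, by simpa using hn', subset_closure ⟨hn', h4⟩⟩,
        ⟨_, by simpa using hn, subset_closure ⟨hn, h3⟩⟩⟩
  have hcov : Metric.sphere (0 : ℂ) r ⊆ closure {w' | ‖w'‖ = r ∧ P + w' ∈ U} ∪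
      closure {w' | ‖w'‖ = r ∧ P + w' ∈ V} := by
    intro z hz
    have hz' : ‖z‖ = r := by simpa using hz
    rw [← closure_union]
    refine mem_closure_of_tendsto ((tendsto_mul_spin z).mono_left
      (nhdsWithin_le_nhds (s := {0}ᶜ))) ?_
    filter_upwards [hD.eventually_not_mem hr hz' P] with τ h
    have : ‖z * spin τ‖ = r := by simp [norm_spin, hz']
    exact (hD.mem_or_mem h).imp (fun h => ⟨this, h⟩) (fun h => ⟨this, h⟩)
  obtain ⟨z, hz, hz1, hz2⟩ := isPreconnected_closed_iff.1 hpc _ _ isClosed_closure isClosed_closure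
    hcov hne.1 hne.2
  exact ⟨z, by simpa using hz, hz1, hz2⟩

end PolygonalInterface

/-! ### Local shape of the interface at a color change -/

namespace PolygonalInterface

variable {D U V : Set ℂ} {r : ℝ} {P w : ℂ}

theorem subset_left_of_inter (hD : PolygonalInterface D U V) {S T : Set ℂ}
    (hT : IsPreconnected T) (hTD : ∀ z ∈ T, z ∉ D) (hne : (S ∩ T).Nonempty) (hS : S ⊆ U) :
    T ⊆ U := by
  refine (hD.subset_or_subset hT hTD).resolve_right fun h => ?_
  obtain ⟨z, hz1, hz2⟩ := hne
  exact hD.not_mem_both (hS hz1) (h hz2)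

/-- Otherwise the open half disc at `P + w` on the inner side of the tangent misses `D` and has one
color. It contains all points of the circle near `P + w` except `P + w` itself, so the color would
not change there. -/
theorem exists_mem_dirs_dot_neg (hD : PolygonalInterface D U V)
    (hw : w ∈ transitions U V r P) : ∃ g ∈ dirs D (P + w), dot w g < 0 := by
  by_contra! hcon
  obtain ⟨ε, hε, h⟩ := hD.exists_radius_mem (P + w)
  set S : Set ℂ := {z | dot (-w) (P + w) < dot (-w) z} ∩ Metric.ball (P + w) ε with hS
  have hpc : IsPreconnected S :=
    ((convex_lt_dot _ _).inter (convex_ball _ _)).isPreconnected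
  have hfree : ∀ z ∈ S, z ∉ D := by
    rintro z ⟨hz1, hz2⟩ hzD
    rw [Metric.mem_ball, dist_eq_norm] at hz2
    simp only [Set.mem_ofPred_eq, neg_dot] at hz1
    rcases h z hzD hz2 with h1 | ⟨e, he, t, ht, -, hz, -⟩
    · rw [h1] at hz1; exact lt_irrefl _ hz1
    · rw [hz, dot_add _ (P + w), dot_real_mul] at hz1
      have := mul_nonneg ht.le (hcon e he)
      linarith
  have hmem : ∀ W : Set ℂ, (∀ z ∈ W, z ∉ D) →
      w ∈ closure {w' | ‖w'‖ = r ∧ P + w' ∈ W} → (S ∩ W).Nonempty := by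
    intro W hW hcl
    obtain ⟨z, ⟨hz1, hz2⟩, hz3⟩ := Metric.mem_closure_iff.1 hcl ε hε
    have hzw : z ≠ w := fun h0 => hW _ hz2 (h0 ▸ hD.mem_of_mem_transitions hw)
    rw [dist_eq_norm] at hz3
    refine ⟨P + z, ⟨?_, ?_⟩, hz2⟩
    · have h1 := norm_sq_add w (z - w)
      rw [add_sub_cancel, hz1, hw.1] at h1
      have h2 : 0 < ‖z - w‖ := norm_pos_iff.2 (sub_ne_zero.2 hzw)
      have h3 : 0 < ‖z - w‖ ^ 2 := by positivity
      simp only [Set.mem_ofPred_eq, neg_dot, dot_add]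
      rw [dot_sub] at h1
      linarith
    · rw [Metric.mem_ball, dist_eq_norm, add_sub_add_left_eq_sub, norm_sub_rev]
      exact hz3
  obtain ⟨x, hx, hxU⟩ := hmem U (fun z hz hzD => hD.not_mem_left hzD hz) hw.2.1
  obtain ⟨y, hy, hyV⟩ := hmem V (fun z hz hzD => hD.not_mem_right hzD hz) hw.2.2
  rcases hD.subset_or_subset hpc hfree with h1 | h1
  · exact hD.not_mem_both (h1 hy) hyV
  · exact hD.not_mem_both hxU (h1 hx)

/-- The interface has no loose ends: a small disc minus one radius is connected, hence of one color,
whereas `P` is in the closure of both. -/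
theorem not_dirs_subset_singleton (hD : PolygonalInterface D U V) (hP : P ∈ D) (e : ℂ) :
    ¬ dirs D P ⊆ {e} := by
  intro hsub
  obtain ⟨e', he'⟩ := hD.dirs_nonempty P hP
  obtain rfl : e' = e := hsub he'
  have he1 : ‖e'‖ = 1 := he'.1
  have hself : dot e' e' = 1 := by rw [dot_self, he1]; norm_num
  obtain ⟨ε, hε, h⟩ := hD.conic P
  have hray : ∀ z ∈ D, ‖z - P‖ < ε → ∃ t : ℝ, 0 ≤ t ∧ z = P + t * e' := by
    intro z hz hzε
    by_cases hzP : z = P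
    · exact ⟨0, le_rfl, by simp [hzP]⟩
    · obtain ⟨g, hg1, hg⟩ := exists_unit_mul hzP
      have hpos : 0 < ‖z - P‖ := norm_pos_iff.2 (sub_ne_zero.2 hzP)
      have hgd := (h g _ hg1 hpos hzε).1 (hg ▸ hz)
      rw [hsub hgd] at hg
      exact ⟨_, hpos.le, hg⟩
  have hb : ∀ (a z : ℂ), z ∈ {z | dot a P < dot a z} ∩ Metric.ball P ε →
      0 < dot a (z - P) ∧ ‖z - P‖ < ε := by
    rintro a z ⟨h1, h2⟩
    rw [Metric.mem_ball, dist_eq_norm] at h2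
    rw [dot_sub]
    exact ⟨sub_pos.2 h1, h2⟩
  have hpc : ∀ a : ℂ, IsPreconnected ({z | dot a P < dot a z} ∩ Metric.ball P ε) := fun a =>
    ((convex_lt_dot _ _).inter (convex_ball _ _)).isPreconnected
  have hfree : ∀ a : ℂ, dot a e' ≤ 0 →
      ∀ z ∈ {z | dot a P < dot a z} ∩ Metric.ball P ε, z ∉ D := by
    intro a ha z hz hzD
    obtain ⟨h1, h2⟩ := hb a z hz
    obtain ⟨t, ht, hzt⟩ := hray z hzD h2
    rw [hzt, add_sub_cancel_left, dot_real_mul] at h1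
    have := mul_nonneg ht (neg_nonneg.2 ha)
    linarith
  have hmeet : ∀ a b u : ℂ, 0 < dot a u → 0 < dot b u →
      (({z | dot a P < dot a z} ∩ Metric.ball P ε) ∩
        ({z | dot b P < dot b z} ∩ Metric.ball P ε)).Nonempty := by
    intro a b u ha hb
    have hu : 0 < ‖u‖ := norm_pos_iff.2 fun h0 => by rw [h0, dot_zero] at ha; exact lt_irrefl _ ha
    have hc : 0 < ε / (2 * ‖u‖) := by positivity
    have hball : P + (ε / (2 * ‖u‖) : ℝ) * u ∈ Metric.ball P ε := by
      rw [Metric.mem_ball, dist_eq_norm, add_sub_cancel_left, norm_mul, Complex.norm_real,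
        Real.norm_of_nonneg hc.le]
      field_simp; norm_num
    refine ⟨P + (ε / (2 * ‖u‖) : ℝ) * u, ⟨?_, hball⟩, ?_, hball⟩
    · simp only [Set.mem_ofPred_eq, dot_add, dot_real_mul]
      have := mul_pos hc ha; linarith
    · simp only [Set.mem_ofPred_eq, dot_add, dot_real_mul]
      have := mul_pos hc hb; linarith
  set a : ℂ := Complex.I * e' with ha
  have e1 : dot a e' = 0 := by simp [ha, dot]; ring
  have e2 : dot a a = 1 := by rw [dot_self, ha, norm_mul, he1]; simp
  have e3 : dot e' a = 0 := by rw [dot_comm, e1]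
  -- the three half discs are disjoint from the interface and cover the disc without a ray
  have hAB := hmeet a (-e') (a - e') (by rw [dot_sub, e1, e2]; norm_num)
    (by rw [neg_dot, dot_sub, e3, hself]; norm_num)
  have hBC := hmeet (-e') (-a) (-a - e') (by rw [neg_dot, dot_sub, dot_neg, e3, hself]; norm_num)
    (by rw [neg_dot, dot_sub, dot_neg, e1, e2]; norm_num)
  have main : ∀ {U V : Set ℂ}, PolygonalInterface D U V →
      {z | dot a P < dot a z} ∩ Metric.ball P ε ⊆ U → False := by
    intro U V hD hA
    have hB := hD.subset_left_of_inter (hpc (-e'))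
      (hfree (-e') (by rw [neg_dot, hself]; norm_num)) hAB hA
    have hC := hD.subset_left_of_inter (hpc (-a)) (hfree (-a) (by rw [neg_dot, e1]; norm_num))
      hBC hB
    obtain ⟨z, hz, hzV⟩ := mem_closure_iff.1 (hD.subset_closure_right hP) _ Metric.isOpen_ball
      (Metric.mem_ball_self hε)
    have hzU : z ∉ U := fun h => hD.not_mem_both h hzV
    have h1 : dot a (z - P) = 0 := by
      rcases lt_trichotomy (dot a (z - P)) 0 with h1 | h1 | h1
      · rw [dot_sub] at h1
        exact absurd (hC ⟨by simp only [Set.mem_ofPred_eq, neg_dot]; linarith, hz⟩) hzU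
      · exact h1
      · rw [dot_sub] at h1
        exact absurd (hA ⟨by simp only [Set.mem_ofPred_eq]; linarith, hz⟩) hzU
    have h2 : 0 ≤ dot e' (z - P) := by
      by_contra! h2
      rw [dot_sub] at h2
      exact absurd (hB ⟨by simp only [Set.mem_ofPred_eq, neg_dot]; linarith, hz⟩) hzU
    have hzP : z ≠ P := fun h0 => hD.not_mem_right hP (h0 ▸ hzV)
    have hpos : 0 < ‖z - P‖ := norm_pos_iff.2 (sub_ne_zero.2 hzP)
    obtain ⟨g, hg1, hg⟩ := exists_unit_mul hzP
    have hcr : dot a (z - P) = cross e' (z - P) := by simp [ha, dot, cross]; ring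
    have hzg : z - P = (‖z - P‖ : ℝ) * g := by linear_combination hg
    have h3 : cross e' g = 0 := by
      rw [hcr, hzg, cross_real_mul] at h1
      exact (mul_eq_zero.1 h1).resolve_left hpos.ne'
    have hge : g = e' := by
      refine (eq_or_eq_neg_of_cross_eq_zero he1 hg1 h3).resolve_right fun h4 => ?_
      rw [hzg, h4, dot_real_mul, dot_neg, hself] at h2
      linarith
    refine hD.not_mem_right ?_ hzV
    rw [hg, hge]
    exact (h e' _ he1 hpos (by simpa [dist_eq_norm] using hz)).2 he'
  rcases hD.subset_or_subset (hpc a) (hfree a e1.le) with h1 | h1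
  · exact main hD h1
  · exact main hD.symm h1

end PolygonalInterface

namespace PolygonalInterface

variable {D U V : Set ℂ} {r : ℝ} {P w : ℂ}

/-- If the interface at `P + w` consists of a ray pointing into the circle with center `P` and a
ray pointing out of it, then the colors change at `P + w` along the circle. -/
theorem mem_transitions (hD : PolygonalInterface D U V) (hw0 : w ≠ 0) {e f : ℂ}
    (hdirs : dirs D (P + w) = {e, f}) (he : 0 < dot w e) (hf : dot w f < 0) :
    w ∈ transitions U V ‖w‖ P := by
  set Q := P + w with hQ
  have hQD : Q ∈ D := hD.mem_of_dirs_nonempty (e := e) (by rw [hdirs]; simp)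
  obtain ⟨ε, hε, h⟩ := hD.conic Q
  -- The slopes of the two rays in the coordinates `dot w` and `cross w`.
  set m := cross w e / dot w e with hm
  set n := cross w f / dot w f with hn
  have hN : 0 < ‖w‖ := norm_pos_iff.2 hw0
  have hloc : ∀ z ∈ D, ‖z - Q‖ < ε → z = Q ∨
      (0 < dot w (z - Q) ∧ cross w (z - Q) = m * dot w (z - Q)) ∨
      (dot w (z - Q) < 0 ∧ cross w (z - Q) = n * dot w (z - Q)) := by
    intro z hz hzε
    by_cases hzQ : z = Q
    · exact Or.inl hzQ
    right
    have ht : 0 < ‖z - Q‖ := norm_pos_iff.2 (sub_ne_zero.2 hzQ)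
    obtain ⟨g, hg1, hzt⟩ := exists_unit_mul hzQ
    have hg : g ∈ dirs D Q := (h g _ hg1 ht hzε).1 (hzt ▸ hz)
    have hzg : z - Q = (‖z - Q‖ : ℝ) * g := by linear_combination hzt
    rw [hdirs] at hg
    rw [hzg, dot_real_mul, cross_real_mul]
    rcases hg with rfl | hg
    · left
      refine ⟨mul_pos ht he, ?_⟩
      rw [hm]; field_simp
    · rw [Set.mem_singleton_iff.1 hg]
      right
      refine ⟨mul_neg_of_pos_of_neg ht hf, ?_⟩
      have := hf.ne
      rw [hn]; field_simp
  have hon : ∀ z ∈ Metric.ball Q ε, ∀ g ∈ dirs D Q,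
      cross w (z - Q) = cross w g / dot w g * dot w (z - Q) → 0 < dot w g * dot w (z - Q) →
      z ∈ D := by
    intro z hz g hg hcr hdot
    have hg0 : dot w g ≠ 0 := fun h0 => by simp [h0] at hdot
    have hzQ : z ≠ Q := fun h0 => by simp [h0, dot_zero] at hdot
    have ht : 0 < ‖z - Q‖ := norm_pos_iff.2 (sub_ne_zero.2 hzQ)
    obtain ⟨k, hk1, hzt⟩ := exists_unit_mul hzQ
    have hzk : z - Q = (‖z - Q‖ : ℝ) * k := by linear_combination hzt
    rw [hzk, dot_real_mul, cross_real_mul] at hcr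
    rw [hzk, dot_real_mul] at hdot
    have h1 : cross w k * dot w g = cross w g * dot w k := by
      field_simp at hcr; linarith
    have h2 : ‖w‖ ^ 2 * cross g k = cross w k * dot w g - cross w g * dot w k := by
      rw [← dot_self]; simp only [dot, cross]; ring
    have h3 : cross g k = 0 := by
      rw [h1, sub_self] at h2
      exact (mul_eq_zero.1 h2).resolve_left (by positivity)
    have hkg : k = g := by
      refine (eq_or_eq_neg_of_cross_eq_zero hg.1 hk1 h3).resolve_right fun h4 => ?_
      rw [h4, dot_neg] at hdot
      have : 0 ≤ ‖z - Q‖ * (dot w g) ^ 2 := by positivity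
      linarith
    rw [hzt]
    exact (h k _ hk1 ht (by simpa [dist_eq_norm] using hz)).2 (hkg ▸ hg)
  -- the two sides of the interface
  set A : ℝ → Set ℂ := fun σ => {z | 0 ≤ dot w (z - Q) ∧ 0 < σ * (cross w (z - Q) -
    m * dot w (z - Q))} ∩ Metric.ball Q ε with hA
  set B : ℝ → Set ℂ := fun σ => {z | dot w (z - Q) ≤ 0 ∧ 0 < σ * (cross w (z - Q) -
    n * dot w (z - Q))} ∩ Metric.ball Q ε with hB
  have hconv : ∀ a b : ℂ, IsPreconnected ({z | 0 ≤ dot a (z - Q) ∧ 0 < dot b (z - Q)} ∩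
      Metric.ball Q ε) := by
    intro a b
    have : {z | 0 ≤ dot a (z - Q) ∧ 0 < dot b (z - Q)} =
        {z | dot a Q ≤ dot a z} ∩ {z | dot b Q < dot b z} := by
      ext z; simp [dot_sub]
    rw [this]
    exact (((convex_le_dot _ _).inter (convex_lt_dot _ _)).inter (convex_ball _ _)).isPreconnected
  have hlin : ∀ (σ k : ℝ) (z : ℂ), σ * (cross w z - k * dot w z) =
      dot ((σ : ℂ) * (Complex.I * w - k * w)) z := by
    intro σ k z; simp [dot, cross]; ring
  have hApc : ∀ σ, IsPreconnected (A σ) := by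
    intro σ
    simp only [hA, hlin]
    exact hconv _ _
  have hBpc : ∀ σ, IsPreconnected (B σ) := by
    intro σ
    have : ∀ z, dot w z ≤ 0 ↔ 0 ≤ dot (-w) z := fun z => by rw [neg_dot]; simp
    simp only [hB, hlin, this]
    exact hconv _ _
  -- A point on the tangent at `Q` lies in both pieces of the side `σ`, so their union is connected.
  have hpoint : ∀ σ : ℝ, σ ≠ 0 → (A σ ∩ B σ).Nonempty := by
    intro σ hσ
    have hc : 0 < ε / (2 * ‖w‖ * |σ|) := by positivity
    set c := ε / (2 * ‖w‖ * |σ|) with hcdef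
    have h1 : dot w ((c * σ : ℝ) * (Complex.I * w)) = 0 := by
      rw [dot_real_mul]; simp [dot]; ring_nf; simp
    have h2 : cross w ((c * σ : ℝ) * (Complex.I * w)) = c * σ * ‖w‖ ^ 2 := by
      rw [cross_real_mul, ← dot_self]; simp [cross, dot]
    have hball : Q + (c * σ : ℝ) * (Complex.I * w) ∈ Metric.ball Q ε := by
      rw [Metric.mem_ball, dist_eq_norm, add_sub_cancel_left, norm_mul, Complex.norm_real, norm_mul,
        norm_mul, Complex.norm_I, one_mul, Real.norm_of_nonneg hc.le, Real.norm_eq_abs, hcdef]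
      have : |σ| ≠ 0 := by positivity
      field_simp; norm_num
    have h3 : 0 < σ * (c * σ * ‖w‖ ^ 2) := by
      have : σ * (c * σ * ‖w‖ ^ 2) = c * (σ * ‖w‖) ^ 2 := by ring
      rw [this]; positivity
    refine ⟨Q + (c * σ : ℝ) * (Complex.I * w), ⟨⟨?_, ?_⟩, hball⟩, ⟨?_, ?_⟩, hball⟩ <;>
      simp only [add_sub_cancel_left, h1, h2, mul_zero, sub_zero] <;>
        first | exact h3 | exact le_rfl
  have hUpc : ∀ σ : ℝ, σ ≠ 0 → IsPreconnected (A σ ∪ B σ) := by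
    intro σ hσ
    obtain ⟨x, hxA, hxB⟩ := hpoint σ hσ
    exact (hApc σ).union x hxA hxB (hBpc σ)
  have hfree : ∀ σ : ℝ, ∀ z ∈ A σ ∪ B σ, z ∉ D := by
    rintro σ z (⟨⟨h1, h2⟩, h3⟩ | ⟨⟨h1, h2⟩, h3⟩) hzD <;>
    · rw [Metric.mem_ball, dist_eq_norm] at h3
      rcases hloc z hzD h3 with rfl | ⟨h4, h5⟩ | ⟨h4, h5⟩
      · simp [dot, cross] at h2
      · first | exact absurd h4 (not_lt.2 h1) | (rw [h5] at h2; simp at h2)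
      · first | exact absurd h4 (not_lt.2 h1) | (rw [h5] at h2; simp at h2)
  have hcover : ∀ z ∈ Metric.ball Q ε, z ∉ D → z ∈ A 1 ∪ B 1 ∨ z ∈ A (-1) ∪ B (-1) := by
    intro z hz hzD
    have hzQ : z ≠ Q := fun h0 => hzD (h0 ▸ hQD)
    have hsgn : ∀ y : ℝ, y ≠ 0 → 0 < 1 * y ∨ 0 < -1 * y := by
      intro y hy
      rcases lt_or_gt_of_ne hy with h1 | h1
      · right; linarith
      · left; linarith
    rcases lt_trichotomy (dot w (z - Q)) 0 with h1 | h1 | h1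
    · have h2 : cross w (z - Q) - n * dot w (z - Q) ≠ 0 := fun h0 =>
        hzD (hon z hz f (by rw [hdirs]; simp) (by rw [← hn]; linarith)
          (mul_pos_of_neg_of_neg hf h1))
      exact (hsgn _ h2).imp (fun h3 => Or.inr ⟨⟨h1.le, h3⟩, hz⟩)
        (fun h3 => Or.inr ⟨⟨h1.le, h3⟩, hz⟩)
    · have h2 := cross_ne_zero_of_dot_eq_zero hw0 (sub_ne_zero.2 hzQ) h1
      have h2' : cross w (z - Q) - n * dot w (z - Q) ≠ 0 := by rwa [h1, mul_zero, sub_zero]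
      exact (hsgn _ h2').imp (fun h3 => Or.inr ⟨⟨h1.le, h3⟩, hz⟩)
        (fun h3 => Or.inr ⟨⟨h1.le, h3⟩, hz⟩)
    · have h2 : cross w (z - Q) - m * dot w (z - Q) ≠ 0 := fun h0 =>
        hzD (hon z hz e (by rw [hdirs]; simp) (by rw [← hm]; linarith) (mul_pos he h1))
      exact (hsgn _ h2).imp (fun h3 => Or.inl ⟨⟨h1.le, h3⟩, hz⟩)
        (fun h3 => Or.inl ⟨⟨h1.le, h3⟩, hz⟩)
  have hsides : ∀ {U V : Set ℂ}, PolygonalInterface D U V → A 1 ∪ B 1 ⊆ U →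
      A (-1) ∪ B (-1) ⊆ V := by
    intro U V hD h1
    refine (hD.subset_or_subset (hUpc (-1) (by norm_num)) (hfree _)).resolve_left fun h2 => ?_
    obtain ⟨z, hz, hzV⟩ := mem_closure_iff.1 (hD.subset_closure_right hQD) _ Metric.isOpen_ball
      (Metric.mem_ball_self hε)
    rcases hcover z hz (fun h => hD.not_mem_right h hzV) with h3 | h3
    · exact hD.not_mem_both (h1 h3) hzV
    · exact hD.not_mem_both (h2 h3) hzV
  have hcirc : ∀ (W : Set ℂ) (σ : ℝ), σ * σ = 1 → A σ ∪ B σ ⊆ W →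
      w ∈ closure {w' | ‖w'‖ = ‖w‖ ∧ P + w' ∈ W} := by
    intro W σ hσ hW
    have hlim : Tendsto (fun s : ℝ => w * spin (σ * s)) (𝓝[>] 0) (𝓝 w) := by
      have h1 : Tendsto (fun s : ℝ => σ * s) (𝓝[>] 0) (𝓝 0) := by
        have hc : ContinuousAt (fun s : ℝ => σ * s) 0 := by fun_prop
        simpa using hc.tendsto.mono_left (nhdsWithin_le_nhds (s := Set.Ioi 0))
      exact (tendsto_mul_spin w).comp h1
    refine mem_closure_of_tendsto hlim ?_
    have hball : ∀ᶠ s : ℝ in 𝓝[>] 0, w * spin (σ * s) ∈ Metric.ball w ε :=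
      hlim.eventually (Metric.ball_mem_nhds w hε)
    -- The circle runs in the inner half plane, where the side is decided by the inner ray of slope
    -- `n`. By the two displacement formulas the circle point is on the side `σ` exactly when `1 + σ
    -- * n * s` is positive.
    have hsmall : ∀ᶠ s : ℝ in 𝓝[>] 0, 0 < 1 + σ * n * s := by
      have hc : ContinuousAt (fun s : ℝ => 1 + σ * n * s) 0 := by fun_prop
      exact (hc.tendsto.mono_left nhdsWithin_le_nhds).eventually_const_lt (by simp)
    filter_upwards [hball, hsmall, self_mem_nhdsWithin] with s h1 h2 h3
    have h3' : 0 < s := h3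
    refine ⟨by simp [norm_spin], hW (Or.inr ⟨⟨?_, ?_⟩, ?_⟩)⟩
    · rw [hQ, add_sub_add_left_eq_sub, dot_mul_spin_sub]
      have : 0 ≤ 2 * (σ * s) ^ 2 / (1 + (σ * s) ^ 2) * ‖w‖ ^ 2 := by positivity
      have h4 : -2 * (σ * s) ^ 2 / (1 + (σ * s) ^ 2) * ‖w‖ ^ 2 =
        -(2 * (σ * s) ^ 2 / (1 + (σ * s) ^ 2) * ‖w‖ ^ 2) := by ring
      rw [h4]; linarith
    · rw [hQ, add_sub_add_left_eq_sub, dot_mul_spin_sub, cross_mul_spin_sub]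
      have h4 : σ * (2 * (σ * s) / (1 + (σ * s) ^ 2) * ‖w‖ ^ 2 -
          n * (-2 * (σ * s) ^ 2 / (1 + (σ * s) ^ 2) * ‖w‖ ^ 2)) =
          2 * s * (σ * σ) * (1 + σ * n * s) / (1 + (σ * s) ^ 2) * ‖w‖ ^ 2 := by
        field_simp; ring
      rw [h4, hσ]; positivity
    · rw [Metric.mem_ball, dist_eq_norm] at h1 ⊢
      rwa [hQ, add_sub_add_left_eq_sub]
  rcases hD.subset_or_subset (hUpc 1 one_ne_zero) (hfree 1) with h1 | h1
  · exact ⟨rfl, hcirc U 1 (by norm_num) h1, hcirc V (-1) (by norm_num) (hsides hD h1)⟩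
  · exact ⟨rfl, hcirc U (-1) (by norm_num) (hsides hD.symm h1), hcirc V 1 (by norm_num) h1⟩

end PolygonalInterface

/-! ### The rays at the two ends of a color change agree -/

namespace PolygonalInterface

variable {D U V : Set ℂ} {r : ℝ} {P w : ℂ}

theorem mem_transitions_of_mul_neg (hD : PolygonalInterface D U V) {e f : ℂ} (hw : ‖w‖ = r)
    (hr : 0 < r)
    (hdirs : dirs D (P + w) = {e, f}) (h : dot w e * dot w f < 0) :
    w ∈ transitions U V r P := by
  have hw0 : w ≠ 0 := norm_pos_iff.1 (hw ▸ hr)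
  rw [← hw]
  rcases mul_neg_iff.1 h with ⟨h1, h2⟩ | ⟨h1, h2⟩
  · exact hD.mem_transitions hw0 hdirs h1 h2
  · exact hD.mem_transitions hw0 (by rw [hdirs, Set.pair_comm]) h2 h1

/-- Two rays of the interface, at two points of the interface at distance `r`, whose inclinations
allow for pairs of points at distance `r` on the two rays, are parallel. -/
theorem cross_eq_zero (hD : PolygonalInterface D U V) (hr : 0 < r)
    (hU : AvoidsEquilateral U r) (hV : AvoidsEquilateral V r) (hw : ‖w‖ = r) {e g : ℂ}
    (he : e ∈ dirs D P) (hg : g ∈ dirs D (P + w)) (h1 : dot w e ≤ 0) (h2 : dot w g < 0) :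
    cross e g = 0 := by
  by_contra hcr
  have he1 : dot e e = 1 := by rw [dot_self, he.1]; norm_num
  have hg1 : dot g g = 1 := by rw [dot_self, hg.1]; norm_num
  have hk : dot e g ^ 2 + cross e g ^ 2 = 1 := by rw [dot_sq_add_cross_sq, he.1, hg.1]; norm_num
  have hcr2 : 0 < cross e g ^ 2 := by positivity
  have hkabs : |dot e g| ≤ 1 := abs_le_one_iff_mul_self_le_one.2 (by nlinarith)
  obtain ⟨hk1, hk2⟩ := abs_le.1 hkabs
  obtain ⟨ε₁, hε₁, hP, -⟩ := hD.exists_radius P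
  obtain ⟨ε₂, hε₂, hQ, hQ'⟩ := hD.exists_radius (P + w)
  obtain ⟨ε₃, hε₃, hR, -⟩ := hD.exists_radius (P - w)
  -- `T` is small enough to bring the moved points closer than `r` when `s` is near `0`, to keep
  -- `dot w' g` negative, and to keep `2 * s * e - t * g` shorter than `ε₃`.
  obtain ⟨T, hT, hT2, hT3, hT4⟩ : ∃ T > 0, T < ε₂ ∧ T < ε₃ / 2 ∧ T < -dot w g / 2 := by
    refine ⟨min (min ε₂ ε₃) (-dot w g) / 4, ?_, ?_, ?_, ?_⟩
    · have : 0 < min (min ε₂ ε₃) (-dot w g) := lt_min (lt_min hε₂ hε₃) (by linarith)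
      positivity
    · have := (min_le_left (min ε₂ ε₃) (-dot w g)).trans (min_le_left _ _); linarith
    · have := (min_le_left (min ε₂ ε₃) (-dot w g)).trans (min_le_right _ _); linarith
    · have := min_le_right (min ε₂ ε₃) (-dot w g); linarith
  have hnorm : ∀ s t : ℝ, ‖w + ((t : ℂ) * g - s * e)‖ ^ 2 =
      r ^ 2 + (2 * (t * dot w g - s * dot w e) + (t ^ 2 - 2 * s * t * dot e g + s ^ 2)) := by
    intro s t
    have : ‖(t : ℂ) * g - s * e‖ ^ 2 = t ^ 2 - 2 * s * t * dot e g + s ^ 2 := by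
      rw [← dot_self]
      have : dot ((t : ℂ) * g - s * e) (t * g - s * e) =
        t ^ 2 * dot g g - 2 * s * t * dot e g + s ^ 2 * dot e e := by simp [dot]; ring
      rw [this, he1, hg1]; ring
    rw [norm_sq_add, hw, this, dot_sub, dot_real_mul, dot_real_mul]; ring
  have hev : ∀ᶠ s : ℝ in 𝓝[>] 0, 2 * (T * dot w g - s * dot w e) +
      (T ^ 2 - 2 * s * T * dot e g + s ^ 2) < 0 ∧ s < ε₁ ∧ s < ε₃ / 4 ∧ s < -dot w g / 2 := by
    have h3 : ∀ᶠ s : ℝ in 𝓝[>] 0, 2 * (T * dot w g - s * dot w e) +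
        (T ^ 2 - 2 * s * T * dot e g + s ^ 2) < 0 := by
      have hc : ContinuousAt (fun s : ℝ => 2 * (T * dot w g - s * dot w e) +
        (T ^ 2 - 2 * s * T * dot e g + s ^ 2)) 0 := by fun_prop
      refine (hc.tendsto.mono_left nhdsWithin_le_nhds).eventually_lt_const ?_
      simp only [zero_mul, sub_zero, mul_zero]
      nlinarith
    have h4 : ∀ a : ℝ, 0 < a → ∀ᶠ s : ℝ in 𝓝[>] 0, s < a := fun a ha =>
      nhdsWithin_le_nhds (Iio_mem_nhds ha)
    exact h3.and ((h4 _ hε₁).and ((h4 _ (by linarith)).and (h4 _ (by linarith))))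
  obtain ⟨δ, hδ, hsub⟩ := mem_nhdsGT_iff_exists_Ioo_subset.1 hev
  -- For every small `s` some `t` puts `P + s * e` and `P + w + t * g` again at distance `r`. Their
  -- difference `w'` is a color change, hence so is `-w'`. So `P - w + (2 * s * e - t * g)` is on
  -- the interface, on one of the finitely many rays at `P - w`.
  have hkey : ∀ s ∈ Set.Ioo 0 δ, ∃ t l : ℝ, ∃ u ∈ dirs D (P - w),
      2 * (t * dot w g - s * dot w e) + (t ^ 2 - 2 * s * t * dot e g + s ^ 2) = 0 ∧
      ((2 * s : ℝ) : ℂ) * e - t * g = l * u := by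
    intro s hs
    obtain ⟨h3, h4, h5, h6⟩ := hsub hs
    have hs0 : 0 < s := hs.1
    set F : ℝ → ℝ := fun t =>
      2 * (t * dot w g - s * dot w e) + (t ^ 2 - 2 * s * t * dot e g + s ^ 2) with hF
    have hF0 : 0 < F 0 := by
      simp only [hF]
      have : 0 ≤ s * -dot w e := mul_nonneg hs0.le (by linarith)
      have := pow_pos hs0 2
      nlinarith
    obtain ⟨t, ⟨ht0, htT⟩, hFt⟩ : (0 : ℝ) ∈ F '' Set.Icc 0 T :=
      intermediate_value_Icc' hT.le (by fun_prop) ⟨h3.le, hF0.le⟩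
    have ht : 0 < t := lt_of_le_of_ne ht0 fun h0 => by rw [← h0] at hFt; linarith
    have hP' : P + s * e ∈ D := (hP e s he.1 hs0 h4).2 he
    have hQd : dirs D (P + w + t * g) = {g, -g} := hQ' g hg t ht (by linarith)
    set w' := w + ((t : ℂ) * g - s * e) with hw'
    have hw'n : ‖w'‖ = r := by
      have h7 := hnorm s t
      have h8 : ‖w'‖ ^ 2 = r ^ 2 := by rw [h7]; simp only [hF] at hFt; rw [hFt, add_zero]
      exact (pow_left_inj₀ (norm_nonneg _) hr.le two_ne_zero).1 h8
    have hadd : P + s * e + w' = P + w + t * g := by rw [hw']; ring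
    have hdot : dot w' g < 0 := by
      have : dot w' g = dot w g + t - s * dot e g := by
        have h9 : dot w' g = dot w g + t * dot g g - s * dot e g := by simp [hw', dot]; ring
        rw [h9, hg1, mul_one]
      rw [this]
      have : -(s * dot e g) ≤ s := by nlinarith
      linarith
    have htr : w' ∈ transitions U V r (P + s * e) := by
      refine hD.mem_transitions_of_mul_neg hw'n hr (by rw [hadd]; exact hQd) ?_
      rw [dot_neg]
      have := mul_pos_of_neg_of_neg hdot hdot
      linarith
    have hmem := hD.mem_of_mem_transitions (hD.neg_mem_transitions hr hU hV hP' htr)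
    have heq : P + s * e + -w' = (P - w) + (((2 * s : ℝ) : ℂ) * e - t * g) := by
      rw [hw']; push_cast; ring
    have hne : ((2 * s : ℝ) : ℂ) * e - t * g ≠ 0 := by
      intro h0
      have h7 : cross (((2 * s : ℝ) : ℂ) * e - t * g) g = 2 * s * cross e g := by
        simp [cross]; ring
      rw [h0] at h7
      have h8 : 2 * s * cross e g = 0 := by rw [← h7]; simp [cross]
      rcases mul_eq_zero.1 h8 with h9 | h9
      · linarith
      · exact hcr h9
    obtain ⟨u, hu1, hu⟩ := exists_unit_mul (z := P - w + (((2 * s : ℝ) : ℂ) * e - t * g))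
      (P := P - w) (by simpa using hne)
    rw [add_sub_cancel_left] at hu
    have hlt : ‖((2 * s : ℝ) : ℂ) * e - t * g‖ < ε₃ := by
      refine (norm_sub_le _ _).trans_lt ?_
      rw [norm_mul, norm_mul, Complex.norm_real, Complex.norm_real, he.1, hg.1,
        Real.norm_of_nonneg (by linarith), Real.norm_of_nonneg ht0]
      linarith
    refine ⟨t, ‖((2 * s : ℝ) : ℂ) * e - t * g‖, u, ?_, hFt, add_left_cancel hu⟩
    rw [← hR u _ hu1 (norm_pos_iff.2 hne) hlt, ← hu, ← heq]
    exact hmem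
  choose! t l u hu hF hl using hkey
  -- Two values of `s` share a ray, which makes the quotients `t / s` equal to one `ρ`. The distance
  -- equation divided by `s` is affine in `s` and vanishes twice, so `ρ ^ 2 - 2 * ρ * dot e g + 1 =
  -- 0`. This has no real solution, as `|dot e g| < 1`.
  obtain ⟨s, hs, s', hs', hne, heq⟩ := (Set.Ioo_infinite hδ).exists_ne_map_eq_of_mapsTo
    (f := u) (fun s hs => hu s hs) (hD.dirs_finite (P - w))
  have h3 : (s * t s' - s' * t s) * cross e g = 0 := by
    have h4 : cross (((2 * s : ℝ) : ℂ) * e - t s * g) (((2 * s' : ℝ) : ℂ) * e - t s' * g) =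
        -2 * ((s * t s' - s' * t s) * cross e g) := by simp [cross]; ring
    have h5 : ∀ a b : ℝ, cross ((a : ℂ) * u s) (b * u s) = 0 := by
      intro a b; simp [cross]; ring
    rw [hl s hs, hl s' hs', ← heq, h5] at h4
    linarith
  have h4 : s * t s' - s' * t s = 0 := (mul_eq_zero.1 h3).resolve_right hcr
  have hs0 : 0 < s := hs.1
  have hs0' : 0 < s' := hs'.1
  set ρ := t s / s with hρ
  have h5 : t s = ρ * s := by rw [hρ]; field_simp
  have h6 : t s' = ρ * s' := by
    rw [hρ]; field_simp; linarith
  have h7 := hF s hs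
  have h8 := hF s' hs'
  rw [h5] at h7
  rw [h6] at h8
  have h9 : 2 * (ρ * dot w g - dot w e) + s * (ρ ^ 2 - 2 * ρ * dot e g + 1) = 0 := by
    refine (mul_eq_zero.1 (?_ : s * _ = 0)).resolve_left hs0.ne'
    linarith
  have h10 : 2 * (ρ * dot w g - dot w e) + s' * (ρ ^ 2 - 2 * ρ * dot e g + 1) = 0 := by
    refine (mul_eq_zero.1 (?_ : s' * _ = 0)).resolve_left hs0'.ne'
    linarith
  have h11 : (s - s') * (ρ ^ 2 - 2 * ρ * dot e g + 1) = 0 := by linarith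
  have h12 := (mul_eq_zero.1 h11).resolve_left (sub_ne_zero.2 hne)
  nlinarith [sq_nonneg (ρ - dot e g)]

/-- At both endpoints of a transition vector, the interface consists of the same two rays, one in
each of the half planes bounded by the normal of the vector. -/
theorem exists_dirs_eq (hD : PolygonalInterface D U V) (hr : 0 < r)
    (hU : AvoidsEquilateral U r) (hV : AvoidsEquilateral V r) (hP : P ∈ D)
    (hw : w ∈ transitions U V r P) :
    ∃ e f, dirs D P = {e, f} ∧ dirs D (P + w) = {e, f} ∧ 0 < dot w e ∧ dot w f < 0 := by
  -- the part of the interface in the half plane `dot w ≤ 0`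
  have half : ∀ {P w : ℂ}, w ∈ transitions U V r P →
      ∃ g ∈ dirs D (P + w), dot w g < 0 ∧ ∀ e ∈ dirs D P, dot w e ≤ 0 → e = g := by
    intro P w hw
    obtain ⟨g, hg, hwg⟩ := hD.exists_mem_dirs_dot_neg hw
    refine ⟨g, hg, hwg, fun e he hwe => ?_⟩
    have h1 := hD.cross_eq_zero hr hU hV hw.1 he hg hwe hwg
    rcases eq_or_eq_neg_of_cross_eq_zero he.1 hg.1 h1 with h2 | h2
    · exact h2.symm
    · rw [h2, dot_neg] at hwg; linarith
  -- Applied to `w` and `-w`, `half` leaves at most one ray at `P` in each half plane; neither can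
  -- be missing, since the interface has no loose ends.
  have two : ∀ {P w : ℂ}, P ∈ D → w ∈ transitions U V r P → ∃ e f, dirs D P = {e, f} ∧
      0 < dot w e ∧ dot w f < 0 ∧ f ∈ dirs D (P + w) := by
    intro P w hP hw
    obtain ⟨f, hf, hwf, hf'⟩ := half hw
    obtain ⟨e, -, hwe, he'⟩ := half (hD.neg_mem_transitions hr hU hV hP hw)
    simp only [neg_dot] at hwe he'
    have hsub : ∀ g ∈ dirs D P, g = e ∨ g = f := by
      intro g hg
      rcases le_total (dot w g) 0 with h | h
      · exact Or.inr (hf' g hg h)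
      · exact Or.inl (he' g hg (by linarith))
    refine ⟨e, f, Set.Subset.antisymm (fun g hg => hsub g hg) ?_, by linarith, hwf, hf⟩
    rintro g (rfl | rfl)
    · by_contra hg
      exact hD.not_dirs_subset_singleton hP f fun k hk =>
        (hsub k hk).resolve_left fun h => hg (h ▸ hk)
    · by_contra hg
      exact hD.not_dirs_subset_singleton hP e fun k hk =>
        (hsub k hk).resolve_right fun h => hg (h ▸ hk)
  obtain ⟨e, f, hef, hwe, hwf, hf⟩ := two hP hw
  have hw0 : 0 < ‖w‖ := hw.1 ▸ hr
  have hQ := hD.mem_of_mem_transitions hw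
  -- The two rays at `P` cross the circle about `P + w`, so the argument can be repeated from the
  -- other end.
  have hw' : -w ∈ transitions U V r (P + w) :=
    hD.mem_transitions_of_mul_neg (by rw [norm_neg, hw.1]) hr
      (by rw [add_neg_cancel_right]; exact hef)
      (by rw [neg_dot, neg_dot, neg_mul_neg]; exact mul_neg_of_pos_of_neg hwe hwf)
  obtain ⟨f', e', hef', hwf', hwe', he'⟩ := two hQ hw'
  rw [add_neg_cancel_right] at he'
  simp only [neg_dot] at hwf' hwe'
  have h1 : e' = e := by
    rw [hef] at he'
    rcases he' with h | h
    · exact h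
    · rw [Set.mem_singleton_iff.1 h] at hwe'; linarith
  have h2 : f' = f := by
    rw [hef'] at hf
    rcases hf with h | h
    · exact h.symm
    · rw [Set.mem_singleton_iff.1 h] at hwf; linarith
  exact ⟨e, f, hef, by rw [hef', h1, h2, Set.pair_comm], hwe, hwf⟩

end PolygonalInterface

/-! ### Persistence of color changes and sectors along the interface -/

/-- Every ray of `D` at `Q` lies on the same side of the normals of `w` and of `s`. -/
def SameSide (D : Set ℂ) (w s Q : ℂ) : Prop := ∀ e ∈ dirs D Q, 0 < dot w e * dot s e

/-- All rays of `D` at `Q` make an angle of less than `π / 6` with the line spanned by `w`. -/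
def Central (D : Set ℂ) (w Q : ℂ) : Prop :=
  SameSide D w (om * w) Q ∧ SameSide D w (w - om * w) Q

theorem IsPreconnected.iff_of_eventually {X : Type*} [TopologicalSpace X] {S : Set X}
    (hS : IsPreconnected S) {A : X → Prop} (h : ∀ x ∈ S, ∀ᶠ y in 𝓝[S] x, (A y ↔ A x)) {x y : X}
    (hx : x ∈ S) (hy : y ∈ S) : A x ↔ A y := by
  refine hS.induction₂' (fun x y => (A x ↔ A y)) (fun x hx => ?_)
    (fun x y z _ _ _ h1 h2 => h1.trans h2) hx hy
  filter_upwards [h x hx] with y hy using ⟨hy.symm, hy⟩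

namespace PolygonalInterface

variable {D U V : Set ℂ} {r : ℝ} {P Q w s : ℂ}

/-- `w - om * w` is `w` rotated by -π/3. -/
theorem sub_om_mul_mem_transitions (hD : PolygonalInterface D U V) (hr : 0 < r)
    (hU : AvoidsEquilateral U r) (hV : AvoidsEquilateral V r) (hP : P ∈ D)
    (hw : w ∈ transitions U V r P) : w - om * w ∈ transitions U V r P := by
  have h := hD.neg_mem_transitions hr hU hV hP (hD.om_mul_mem_transitions hr hU hV hP
    (hD.om_mul_mem_transitions hr hU hV hP hw))
  have h2 : -(om * (om * w)) = w - om * w := by linear_combination -w * om_sq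
  rwa [h2] at h

theorem dot_ne_zero (hD : PolygonalInterface D U V) (hr : 0 < r)
    (hU : AvoidsEquilateral U r) (hV : AvoidsEquilateral V r) (hP : P ∈ D)
    (hw : w ∈ transitions U V r P) {e : ℂ} (he : e ∈ dirs D P) : dot w e ≠ 0 := by
  obtain ⟨a, b, h1, -, h3, h4⟩ := hD.exists_dirs_eq hr hU hV hP hw
  rw [h1] at he
  rcases he with rfl | he
  · exact h3.ne'
  · rw [Set.mem_singleton_iff.1 he]; exact h4.ne

/-- A partial converse of `exists_dirs_eq`. If the second ray `g` at `Q + s` were on the same side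
of the normal as `e`, or on the normal, then `cross_eq_zero`, read from `Q + s` back to `Q`, would
make `g` parallel to `e`. -/
theorem mem_transitions_of_mem_dirs (hD : PolygonalInterface D U V) (hr : 0 < r)
    (hU : AvoidsEquilateral U r) (hV : AvoidsEquilateral V r) (hs : ‖s‖ = r) {e : ℂ}
    (h1 : e ∈ dirs D Q) (h2 : e ∈ dirs D (Q + s)) (h3 : 0 < dot s e) :
    s ∈ transitions U V r Q := by
  have hQs := hD.mem_of_dirs_nonempty h2
  obtain ⟨w, hw⟩ := hD.transitions_nonempty hr hU hV hQs
  obtain ⟨a, b, hab, -, h4, h5⟩ := hD.exists_dirs_eq hr hU hV hQs hw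
  obtain ⟨g, hg, hge⟩ : ∃ g, dirs D (Q + s) = {e, g} ∧ g ≠ e := by
    have hne : a ≠ b := fun h => by rw [h] at h4; linarith
    rw [hab] at h2
    rcases h2 with rfl | h2
    · exact ⟨b, hab, hne.symm⟩
    · rw [Set.mem_singleton_iff.1 h2]
      exact ⟨a, by rw [hab, Set.pair_comm], hne⟩
  refine hD.mem_transitions_of_mul_neg hs hr hg (mul_neg_of_pos_of_neg h3 ?_)
  by_contra! h6
  have h7 : cross g e = 0 := by
    refine hD.cross_eq_zero hr hU hV (P := Q + s) (w := -s) (by rw [norm_neg, hs])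
      (by rw [hg]; simp) (by rwa [add_neg_cancel_right]) ?_ ?_
    · rw [neg_dot]; linarith
    · rw [neg_dot]; linarith
  rcases eq_or_eq_neg_of_cross_eq_zero (show ‖g‖ = 1 from
    (show g ∈ dirs D (Q + s) by rw [hg]; simp).1) h1.1 h7 with h8 | h8
  · exact hge h8.symm
  · rw [h8, dot_neg] at h3; linarith

/-- Being a transition vector is a locally constant property along the interface. -/
theorem eventually_mem_transitions_iff (hD : PolygonalInterface D U V) (hr : 0 < r)
    (hU : AvoidsEquilateral U r) (hV : AvoidsEquilateral V r) (hQ : Q ∈ D) (s : ℂ) :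
    ∀ᶠ Q' in 𝓝[D] Q, (s ∈ transitions U V r Q' ↔ s ∈ transitions U V r Q) := by
  obtain ⟨ε₁, hε₁, h1⟩ := hD.exists_radius_mem Q
  obtain ⟨ε₂, hε₂, h2, h2'⟩ := hD.exists_radius (Q + s)
  obtain ⟨ε₃, hε₃, h3, -⟩ := hD.exists_radius (Q - s)
  have hball := Metric.ball_mem_nhds Q (lt_min (lt_min hε₁ hε₂) hε₃)
  filter_upwards [self_mem_nhdsWithin, nhdsWithin_le_nhds hball] with Q' hQ' hQ'b
  rw [Metric.mem_ball, dist_eq_norm, lt_min_iff, lt_min_iff] at hQ'b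
  obtain ⟨⟨hb1, hb2⟩, hb3⟩ := hQ'b
  rcases h1 Q' hQ' hb1 with rfl | ⟨e, he, t, ht, -, hQe, hdirs⟩
  · rfl
  have hnt : ‖Q' - Q‖ = t := by
    rw [hQe, add_sub_cancel_left, norm_mul, he.1, Complex.norm_real, Real.norm_of_nonneg ht.le,
      mul_one]
  rw [hnt] at hb2 hb3
  constructor
  · intro hs
    have hs' := hD.neg_mem_transitions hr hU hV hQ' hs
    -- Since `s` and `-s` are color changes at `Q + t * e`, both `Q + s` and `Q - s` have the ray
    -- `e`. The one of `s` and `-s` that has positive product with `e` is then a color change at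
    -- `Q`.
    have hplus : e ∈ dirs D (Q + s) := by
      rw [← h2 e t he.1 ht hb2]
      have := hD.mem_of_mem_transitions hs
      rw [hQe] at this
      convert this using 1; ring
    have hminus : e ∈ dirs D (Q + -s) := by
      rw [← sub_eq_add_neg, ← h3 e t he.1 ht hb3]
      have := hD.mem_of_mem_transitions hs'
      rw [hQe] at this
      convert this using 1; ring
    have hne := hD.dot_ne_zero hr hU hV hQ' hs (e := e) (by rw [hdirs]; simp)
    rcases lt_or_gt_of_ne hne with h4 | h4
    · have := hD.neg_mem_transitions hr hU hV hQ (hD.mem_transitions_of_mem_dirs hr hU hV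
        (by rw [norm_neg, hs.1]) he hminus (by rw [neg_dot]; linarith))
      rwa [neg_neg] at this
    · exact hD.mem_transitions_of_mem_dirs hr hU hV hs.1 he hplus h4
  · intro hs
    obtain ⟨a, b, hab, hab', -, -⟩ := hD.exists_dirs_eq hr hU hV hQ hs
    have hes : e ∈ dirs D (Q + s) := by rw [hab', ← hab]; exact he
    refine hD.mem_transitions_of_mul_neg hs.1 hr (e := e) (f := -e) ?_ ?_
    · rw [← h2' e hes t ht hb2, hQe]; congr 1; ring
    · have := hD.dot_ne_zero hr hU hV hQ hs he
      rw [dot_neg]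
      have : 0 < dot s e * dot s e := mul_self_pos.2 this
      linarith

/-- There are just two rays at `Q`, and the normals of `w` and `s` both separate them, so agreement
on one ray implies agreement on the other. -/
theorem sameSide_of_mem (hD : PolygonalInterface D U V) (hr : 0 < r)
    (hU : AvoidsEquilateral U r) (hV : AvoidsEquilateral V r) (hQ : Q ∈ D)
    (hw : w ∈ transitions U V r Q) (hs : s ∈ transitions U V r Q) {e : ℂ} (he : e ∈ dirs D Q)
    (h : 0 < dot w e * dot s e) : SameSide D w s Q := by
  obtain ⟨a, b, h1, -, h2, h3⟩ := hD.exists_dirs_eq hr hU hV hQ hw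
  obtain ⟨c, d, h1', -, h2', h3'⟩ := hD.exists_dirs_eq hr hU hV hQ hs
  have ha : a = c ∨ a = d := by
    have : a ∈ dirs D Q := by rw [h1]; simp
    rw [h1'] at this; simpa using this
  have hb : b = c ∨ b = d := by
    have : b ∈ dirs D Q := by rw [h1]; simp
    rw [h1'] at this; simpa using this
  intro g hg
  rw [h1] at he hg
  have hab : a ≠ b := fun h => by rw [h] at h2; linarith
  rcases ha with rfl | rfl <;> rcases hb with rfl | rfl
  · exact absurd rfl hab
  · rcases hg with rfl | hg
    · exact mul_pos h2 h2'
    · rw [Set.mem_singleton_iff.1 hg]; exact mul_pos_of_neg_of_neg h3 h3'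
  · rcases he with rfl | he
    · have := mul_neg_of_pos_of_neg h2 h3'; linarith
    · rw [Set.mem_singleton_iff.1 he] at h
      have := mul_neg_of_neg_of_pos h3 h2'; linarith
  · exact absurd rfl hab

theorem eventually_sameSide_iff (hD : PolygonalInterface D U V) (hr : 0 < r)
    (hU : AvoidsEquilateral U r) (hV : AvoidsEquilateral V r) (hQ : Q ∈ D)
    (hw : w ∈ transitions U V r Q) (hs : s ∈ transitions U V r Q) :
    ∀ᶠ Q' in 𝓝[D] Q, (SameSide D w s Q' ↔ SameSide D w s Q) := by
  obtain ⟨ε, hε, h⟩ := hD.exists_radius_mem Q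
  filter_upwards [self_mem_nhdsWithin, nhdsWithin_le_nhds (Metric.ball_mem_nhds Q hε)] with
    Q' hQ' hQ'b
  rw [Metric.mem_ball, dist_eq_norm] at hQ'b
  rcases h Q' hQ' hQ'b with rfl | ⟨e, he, t, ht, -, hQe, hdirs⟩
  · rfl
  constructor
  · intro h1
    exact hD.sameSide_of_mem hr hU hV hQ hw hs he (h1 e (by rw [hdirs]; simp))
  · intro h1 g hg
    rw [hdirs] at hg
    rcases hg with rfl | hg
    · exact h1 _ he
    · rw [Set.mem_singleton_iff.1 hg, dot_neg, dot_neg, neg_mul_neg]; exact h1 _ he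

/-- No ray is orthogonal to any of the six rotated copies of a color change, so the line of a ray
has a unique nearest one among their three axes, at an angle of less than π/6. -/
theorem exists_central (hD : PolygonalInterface D U V) (hr : 0 < r)
    (hU : AvoidsEquilateral U r) (hV : AvoidsEquilateral V r) (hP : P ∈ D) :
    ∃ w ∈ transitions U V r P, Central D w P := by
  obtain ⟨w, hw⟩ := hD.transitions_nonempty hr hU hV hP
  obtain ⟨e, he⟩ := hD.dirs_nonempty P hP
  have hw1 := hD.om_mul_mem_transitions hr hU hV hP hw
  have hw2 := hD.sub_om_mul_mem_transitions hr hU hV hP hw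
  have hw3 := hD.neg_mem_transitions hr hU hV hP hw1
  have hw4 := hD.neg_mem_transitions hr hU hV hP hw2
  have h0 := hD.dot_ne_zero hr hU hV hP hw he
  have h1 := hD.dot_ne_zero hr hU hV hP hw1 he
  have h2 := hD.dot_ne_zero hr hU hV hP hw2 he
  have hsum : dot w e = dot (om * w) e + dot (w - om * w) e := by simp [dot]; ring
  have e1 : om * (om * w) = -(w - om * w) := by linear_combination w * om_sq
  have e2 : om * w - om * (om * w) = w := by linear_combination -w * om_sq
  have e3 : om * (w - om * w) = w := by linear_combination -w * om_sq
  have e4 : w - om * w - om * (w - om * w) = -(om * w) := by rw [e3]; ring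
  have key : ∀ {a b c : ℂ}, a ∈ transitions U V r P → b ∈ transitions U V r P →
      c ∈ transitions U V r P → 0 < dot a e * dot b e → 0 < dot a e * dot c e →
      SameSide D a b P ∧ SameSide D a c P := fun ha hb hc h3 h4 =>
    ⟨hD.sameSide_of_mem hr hU hV hP ha hb he h3, hD.sameSide_of_mem hr hU hV hP ha hc he h4⟩
  unfold Central
  -- The signs of the three products select the axis; `hsum` rules out the two patterns in which
  -- `dot w e` has the sign opposite to both summands.
  rcases lt_or_gt_of_ne h0 with h0 | h0 <;> rcases lt_or_gt_of_ne h1 with h1 | h1 <;>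
    rcases lt_or_gt_of_ne h2 with h2 | h2
  · exact ⟨w, hw, key hw hw1 hw2 (mul_pos_of_neg_of_neg h0 h1) (mul_pos_of_neg_of_neg h0 h2)⟩
  · refine ⟨om * w, hw1, ?_⟩
    rw [e2, e1]
    exact key hw1 hw4 hw (by rw [neg_dot]; nlinarith) (mul_pos_of_neg_of_neg h1 h0)
  · refine ⟨w - om * w, hw2, ?_⟩
    rw [e4, e3]
    exact key hw2 hw hw3 (mul_pos_of_neg_of_neg h2 h0) (by rw [neg_dot]; nlinarith)
  · linarith
  · linarith
  · refine ⟨w - om * w, hw2, ?_⟩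
    rw [e4, e3]
    exact key hw2 hw hw3 (mul_pos h2 h0) (by rw [neg_dot]; nlinarith)
  · refine ⟨om * w, hw1, ?_⟩
    rw [e2, e1]
    exact key hw1 hw4 hw (by rw [neg_dot]; nlinarith) (mul_pos h1 h0)
  · exact ⟨w, hw, key hw hw1 hw2 (mul_pos h0 h1) (mul_pos h0 h2)⟩

variable {S : Set ℝ} {H : ℝ → ℂ} {x y : ℝ}

/-- Transition vectors persist along curves in the interface. -/
theorem mem_transitions_along (hD : PolygonalInterface D U V) (hr : 0 < r)
    (hU : AvoidsEquilateral U r) (hV : AvoidsEquilateral V r) (hS : IsPreconnected S)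
    (hH : ContinuousOn H S) (hHD : Set.MapsTo H S D) (hx : x ∈ S) (hy : y ∈ S)
    (h : s ∈ transitions U V r (H x)) : s ∈ transitions U V r (H y) := by
  refine (hS.iff_of_eventually (A := fun x => s ∈ transitions U V r (H x)) (fun z hz => ?_)
    hx hy).1 h
  have ht : Tendsto H (𝓝[S] z) (𝓝[D] (H z)) := (hH z hz).tendsto_nhdsWithin hHD
  exact ht.eventually (hD.eventually_mem_transitions_iff hr hU hV (hHD hz) s)

theorem sameSide_along (hD : PolygonalInterface D U V) (hr : 0 < r)
    (hU : AvoidsEquilateral U r) (hV : AvoidsEquilateral V r) (hS : IsPreconnected S)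
    (hH : ContinuousOn H S) (hHD : Set.MapsTo H S D) (hx : x ∈ S) (hy : y ∈ S)
    (hw : w ∈ transitions U V r (H x)) (hs : s ∈ transitions U V r (H x))
    (h : SameSide D w s (H x)) : SameSide D w s (H y) := by
  refine (hS.iff_of_eventually (A := fun x => SameSide D w s (H x)) (fun z hz => ?_)
    hx hy).1 h
  have ht : Tendsto H (𝓝[S] z) (𝓝[D] (H z)) := (hH z hz).tendsto_nhdsWithin hHD
  exact ht.eventually (hD.eventually_sameSide_iff hr hU hV (hHD hz)
    (hD.mem_transitions_along hr hU hV hS hH hHD hx hz hw)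
    (hD.mem_transitions_along hr hU hV hS hH hHD hx hz hs))

end PolygonalInterface

/-! ### Curves in the interface -/

/-- A curve in `D` that starts at `Q` and is parametrized over `[0, δ]` by its `w`-coordinate. -/
def HasArc (D : Set ℂ) (w : ℂ) (K : ℝ) (Q : ℂ) (δ : ℝ) : Prop :=
  ∃ H : ℝ → ℂ, Continuous H ∧ H 0 = Q ∧ ∀ x ∈ Set.Icc 0 δ,
    H x ∈ D ∧ dot w (H x) = dot w Q + x ∧ ‖H x - Q‖ ≤ K * x

theorem HasArc.mono {D : Set ℂ} {w Q : ℂ} {K δ δ' : ℝ} (h : HasArc D w K Q δ) (hδ : δ' ≤ δ) :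
    HasArc D w K Q δ' := by
  obtain ⟨H, h1, h2, h3⟩ := h
  exact ⟨H, h1, h2, fun x hx => h3 x ⟨hx.1, hx.2.trans hδ⟩⟩

/-- A curve in `D` that is parametrized by its `w`-coordinate. -/
structure IsCurve (D : Set ℂ) (w : ℂ) (H : ℝ → ℂ) : Prop where
  continuous : Continuous H
  mem : ∀ x, H x ∈ D
  dot_eq : ∀ x, dot w (H x) = dot w (H 0) + x

namespace PolygonalInterface

variable {D U V : Set ℂ} {r : ℝ} {P Q w s : ℂ}

/-- Near a point with rays on both sides of the normal of `w`, the interface is a graph. -/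
theorem exists_chart (hD : PolygonalInterface D U V) {e f : ℂ} {K : ℝ}
    (hdirs : dirs D Q = {e, f}) (he : 0 < dot w e) (hf : dot w f < 0)
    (hK : ∀ g ∈ dirs D Q, 1 ≤ K * |dot w g|) :
    ∃ a b : ℂ, dot w a = 1 ∧ dot w b = 1 ∧ ‖a‖ ≤ K ∧ ‖b‖ ≤ K ∧ ∃ ε > 0, ∀ z, ‖z - Q‖ < ε →
      (z ∈ D ↔ z = Q + ((max (dot w (z - Q)) 0 : ℝ) * a + (min (dot w (z - Q)) 0 : ℝ) * b)) := by
  have hed : e ∈ dirs D Q := by rw [hdirs]; simp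
  have hfd : f ∈ dirs D Q := by rw [hdirs]; simp
  have hQ := hD.mem_of_dirs_nonempty hed
  have hnorm : ∀ g ∈ dirs D Q, dot w g ≠ 0 → ‖((dot w g)⁻¹ : ℝ) * g‖ ≤ K := by
    intro g hg h0
    rw [norm_mul, hg.1, Complex.norm_real, mul_one, norm_inv, Real.norm_eq_abs,
      inv_le_iff_one_le_mul₀ (abs_pos.2 h0)]
    exact hK g hg
  obtain ⟨ε, hε, h, -⟩ := hD.exists_radius Q
  refine ⟨((dot w e)⁻¹ : ℝ) * e, ((dot w f)⁻¹ : ℝ) * f, ?_, ?_, hnorm e hed he.ne',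
    hnorm f hfd hf.ne, ε, hε, fun z hz => ⟨fun hzD => ?_, fun hzD => ?_⟩⟩
  · rw [dot_real_mul, inv_mul_cancel₀ he.ne']
  · rw [dot_real_mul, inv_mul_cancel₀ hf.ne]
  · by_cases hzQ : z = Q
    · simp [hzQ, dot_zero]
    · obtain ⟨g, hg1, hg⟩ := exists_unit_mul hzQ
      have hpos : 0 < ‖z - Q‖ := norm_pos_iff.2 (sub_ne_zero.2 hzQ)
      have hgd : g ∈ dirs D Q := (h g _ hg1 hpos hz).1 (hg ▸ hzD)
      set t := ‖z - Q‖
      rw [hdirs] at hgd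
      have hX : dot w (z - Q) = t * dot w g := by rw [hg, add_sub_cancel_left, dot_real_mul]
      rcases hgd with rfl | hgd
      · rw [hX, max_eq_left (by positivity), min_eq_right (by positivity), ← mul_assoc,
          ← Complex.ofReal_mul, mul_assoc, mul_inv_cancel₀ he.ne']
        simpa using hg
      · rw [Set.mem_singleton_iff.1 hgd] at hg hX
        have h1 : t * dot w f ≤ 0 := (mul_neg_of_pos_of_neg hpos hf).le
        rw [hX, max_eq_right h1, min_eq_left h1, ← mul_assoc ((t * dot w f : ℝ) : ℂ),
          ← Complex.ofReal_mul, mul_assoc t, mul_inv_cancel₀ hf.ne]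
        simpa using hg
  · have main : ∀ g ∈ dirs D Q, 0 < dot w (z - Q) * (dot w g)⁻¹ →
        z = Q + (dot w (z - Q) * (dot w g)⁻¹ : ℝ) * g → z ∈ D := by
      intro g hg hpos hzg
      set t := dot w (z - Q) * (dot w g)⁻¹
      have ht : ‖z - Q‖ = t := by
        rw [hzg, add_sub_cancel_left, norm_mul, hg.1, Complex.norm_real,
          Real.norm_of_nonneg hpos.le, mul_one]
      rw [hzg]
      exact (h g t hg.1 hpos (ht ▸ hz)).2 hg
    rcases lt_trichotomy (dot w (z - Q)) 0 with h1 | h1 | h1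
    · rw [max_eq_right h1.le, min_eq_left h1.le] at hzD
      refine main f hfd (mul_pos_of_neg_of_neg h1 (inv_neg''.2 hf)) ?_
      rw [Complex.ofReal_mul, mul_assoc]
      simpa using hzD
    · rw [h1] at hzD
      simp only [max_self, min_self, Complex.ofReal_zero, zero_mul, add_zero] at hzD
      rwa [hzD]
    · rw [max_eq_left h1.le, min_eq_right h1.le] at hzD
      refine main e hed (mul_pos h1 (inv_pos.2 he)) ?_
      rw [Complex.ofReal_mul, mul_assoc]
      simpa using hzD

/-- Curves in the interface are determined by their `w`-coordinates and one common point. -/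
theorem eqOn_of_dot_eq (hD : PolygonalInterface D U V) {S : Set ℝ} {α β : ℝ → ℂ} {x : ℝ}
    (hS : IsPreconnected S) (hα : ContinuousOn α S) (hβ : ContinuousOn β S)
    (hαD : Set.MapsTo α S D) (hβD : Set.MapsTo β S D)
    (hdot : ∀ y ∈ S, dot w (α y) = dot w (β y)) (hx : x ∈ S) (h : α x = β x)
    (hw : ∀ y ∈ S, ∃ e f, dirs D (α y) = {e, f} ∧ 0 < dot w e ∧ dot w f < 0) :
    Set.EqOn α β S := by
  intro y hy
  refine (hS.iff_of_eventually (A := fun x => α x = β x) (fun z hz => ?_) hx hy).1 h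
  by_cases hz' : α z = β z
  · obtain ⟨e, f, h1, h2, h3⟩ := hw z hz
    -- Any bound for both reciprocals serves as `K`; their sum is one.
    have hK : ∀ g ∈ dirs D (α z), 1 ≤ (1 / dot w e + 1 / -dot w f) * |dot w g| := by
      intro g hg
      rw [h1] at hg
      have h4 : 0 < 1 / dot w e := by positivity
      have h5 : 0 < 1 / -dot w f := one_div_pos.2 (by linarith)
      rcases hg with rfl | hg
      · rw [abs_of_pos h2, add_mul, one_div_mul_cancel h2.ne']
        have := mul_pos h5 h2; linarith
      · rw [Set.mem_singleton_iff.1 hg, abs_of_neg h3, add_mul,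
          one_div_mul_cancel (by linarith : -dot w f ≠ 0)]
        have := mul_pos h4 (neg_pos.2 h3); linarith
    obtain ⟨a, b, -, -, -, -, ε, hε, hch⟩ := hD.exists_chart h1 h2 h3 hK
    have h4 : ∀ᶠ t in 𝓝[S] z, α t ∈ Metric.ball (α z) ε :=
      (hα z hz).tendsto.eventually (Metric.ball_mem_nhds _ hε)
    have h5 : ∀ᶠ t in 𝓝[S] z, β t ∈ Metric.ball (α z) ε := by
      rw [hz']
      exact (hβ z hz).tendsto.eventually (Metric.ball_mem_nhds _ hε)
    filter_upwards [h4, h5, self_mem_nhdsWithin] with t h6 h7 ht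
    rw [Metric.mem_ball, dist_eq_norm] at h6 h7
    simp only [hz', iff_true]
    rw [(hch _ h6).1 (hαD ht), (hch _ h7).1 (hβD ht), dot_sub, dot_sub, hdot t ht]
  · have : ∀ᶠ t in 𝓝[S] z, α t - β t ≠ 0 :=
      ((hα z hz).sub (hβ z hz)).tendsto.eventually_ne (sub_ne_zero.2 hz')
    filter_upwards [this] with t ht
    simp [sub_ne_zero.1 ht, hz']

/-- Angles below π/6 have cosine above 1/2. The bound is uniform over all central points, so that a
curve cannot run off to infinity over a bounded range of its `w`-coordinate. -/
theorem one_le_of_central (hr : 0 < r) (hw : ‖w‖ = r) (hc : Central D w Q) :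
    ∀ g ∈ dirs D Q, 1 ≤ 2 / r * |dot w g| := by
  intro g hg
  have h1 := hc.1 g hg
  have h2 := hc.2 g hg
  have h3 : dot (w - om * w) g = dot w g / 2 - √3 / 2 * cross w g := by
    simp [dot, cross]; ring
  rw [dot_om_mul] at h1
  rw [h3] at h2
  have hs : √3 * √3 = 3 := Real.mul_self_sqrt (by norm_num)
  have h4 := dot_sq_add_cross_sq w g
  rw [hg.1, hw] at h4
  have h5 : 0 < dot w g ^ 2 := by
    have : dot w g ≠ 0 := fun h => by simp [h] at h1
    positivity
  have h6 : 0 < dot w g ^ 2 * (dot w g ^ 2 / 4 - 3 / 4 * cross w g ^ 2) := by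
    have := mul_pos h1 h2
    have h7 : dot w g * (dot w g / 2 + √3 / 2 * cross w g) *
        (dot w g * (dot w g / 2 - √3 / 2 * cross w g)) =
        dot w g ^ 2 * (dot w g ^ 2 / 4 - (√3 * √3) / 4 * cross w g ^ 2) := by ring
    rwa [h7, hs] at this
  have h7 := (mul_pos_iff_of_pos_left h5).1 h6
  have h8 : (r / 2) ^ 2 ≤ |dot w g| ^ 2 := by rw [sq_abs]; nlinarith
  have h9 := (pow_le_pow_iff_left₀ (by positivity) (abs_nonneg _) two_ne_zero).1 h8
  rw [div_mul_eq_mul_div, one_le_div hr]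
  linarith

/-- The chart at `Q` serves all nearby starting points, so the length of the arc is locally uniform,
as the compactness argument in `hasArc` requires. -/
theorem exists_hasArc (hD : PolygonalInterface D U V) (hr : 0 < r)
    (hU : AvoidsEquilateral U r) (hV : AvoidsEquilateral V r) (hQ : Q ∈ D)
    (hw : w ∈ transitions U V r Q) (hc : Central D w Q) :
    ∃ δ > 0, ∀ᶠ Q' in 𝓝[D] Q, HasArc D w (2 / r) Q' δ := by
  obtain ⟨e, f, h1, -, h2, h3⟩ := hD.exists_dirs_eq hr hU hV hQ hw
  obtain ⟨a, b, ha, hb, hna, hnb, ε, hε, hch⟩ := hD.exists_chart h1 h2 h3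
    (one_le_of_central hr hw.1 hc)
  set K := 2 / r with hKdef
  have hK : 0 < K := by positivity
  set γ : ℝ → ℂ := fun x => Q + ((max x 0 : ℝ) * a + (min x 0 : ℝ) * b) with hγ
  have hγc : Continuous γ := by
    have h1 : Continuous fun x : ℝ => ((max x 0 : ℝ) : ℂ) :=
      Complex.continuous_ofReal.comp (continuous_id.max continuous_const)
    have h2 : Continuous fun x : ℝ => ((min x 0 : ℝ) : ℂ) :=
      Complex.continuous_ofReal.comp (continuous_id.min continuous_const)
    exact continuous_const.add ((h1.mul continuous_const).add (h2.mul continuous_const))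
  have hγd : ∀ x, dot w (γ x) = dot w Q + x := by
    intro x
    simp only [hγ, dot_add, dot_real_mul, ha, hb, mul_one]
    rw [max_add_min, add_zero]
  have hγK : ∀ x y, x ≤ y → ‖γ y - γ x‖ ≤ K * (y - x) := by
    intro x y hxy
    have h4 : γ y - γ x = (max y 0 - max x 0 : ℝ) * a + (min y 0 - min x 0 : ℝ) * b := by
      simp only [hγ]; push_cast; ring
    have h5 : 0 ≤ max y 0 - max x 0 := sub_nonneg.2 (max_le_max_right _ hxy)
    have h6 : 0 ≤ min y 0 - min x 0 := sub_nonneg.2 (min_le_min_right _ hxy)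
    have h7 : (max y 0 - max x 0) + (min y 0 - min x 0) = y - x := by
      linarith [max_add_min y 0, max_add_min x 0]
    rw [h4, ← h7, mul_add]
    refine (norm_add_le _ _).trans (add_le_add ?_ ?_)
    · rw [norm_mul, Complex.norm_real, Real.norm_of_nonneg h5, mul_comm]
      exact mul_le_mul_of_nonneg_right hna h5
    · rw [norm_mul, Complex.norm_real, Real.norm_of_nonneg h6, mul_comm]
      exact mul_le_mul_of_nonneg_right hnb h6
  have hγ0 : γ 0 = Q := by simp [hγ]
  have hγD : ∀ x, K * |x| < ε → γ x ∈ D := by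
    intro x hx
    have h4 : ‖γ x - Q‖ < ε := by
      refine lt_of_le_of_lt ?_ hx
      rcases le_total 0 x with h | h
      · have := hγK 0 x h
        rw [abs_of_nonneg h]
        rwa [hγ0, sub_zero] at this
      · have := hγK x 0 h
        rw [abs_of_nonpos h]
        rwa [hγ0, zero_sub, norm_sub_rev] at this
    refine (hch _ h4).2 ?_
    rw [dot_sub, hγd, add_sub_cancel_left]
  -- The arc accounts for at most `ε / 4` and the shifted starting point for less than `ε / 2` of
  -- the chart's radius.
  refine ⟨ε / (4 * K), by positivity, ?_⟩
  have h4 : ∀ᶠ Q' in 𝓝 Q, K * |dot w (Q' - Q)| < ε / 2 := by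
    have hcont : ContinuousAt (fun Q' => K * |dot w (Q' - Q)|) Q := by
      have := continuous_dot w
      fun_prop
    exact hcont.tendsto.eventually_lt_const (by simp [dot_zero, hε])
  filter_upwards [self_mem_nhdsWithin, nhdsWithin_le_nhds (Metric.ball_mem_nhds Q hε),
    nhdsWithin_le_nhds h4] with Q' hQ' hball hsmall
  rw [Metric.mem_ball, dist_eq_norm] at hball
  have hQ'γ : γ (dot w (Q' - Q)) = Q' := ((hch _ hball).1 hQ').symm
  refine ⟨fun x => γ (dot w (Q' - Q) + x), hγc.comp (by fun_prop), by simp [hQ'γ], ?_⟩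
  rintro x ⟨hx0, hx⟩
  refine ⟨hγD _ ?_, ?_, ?_⟩
  · have h5 : K * x ≤ ε / 4 := by
      have := mul_le_mul_of_nonneg_left hx hK.le
      have h6 : K * (ε / (4 * K)) = ε / 4 := by field_simp
      linarith
    have h6 := abs_add_le (dot w (Q' - Q)) x
    rw [abs_of_nonneg hx0] at h6
    have := mul_le_mul_of_nonneg_left h6 hK.le
    linarith
  · rw [hγd, dot_sub]; ring
  · have := hγK (dot w (Q' - Q)) (dot w (Q' - Q) + x) (by linarith)
    rwa [hQ'γ, add_sub_cancel_left] at this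

end PolygonalInterface

namespace PolygonalInterface

variable {D U V : Set ℂ} {r : ℝ} {P Q w s : ℂ}

/-- `D` is closed, and both further conditions are locally constant along `D`. -/
theorem isClosed_central (hD : PolygonalInterface D U V) (hr : 0 < r)
    (hU : AvoidsEquilateral U r) (hV : AvoidsEquilateral V r) (w : ℂ) :
    IsClosed {Q | Q ∈ D ∧ w ∈ transitions U V r Q ∧ Central D w Q} := by
  refine isClosed_of_closure_subset fun Q hQ => ?_
  have hQD : Q ∈ D := by
    have := closure_mono (fun z hz => hz.1 : {Q | Q ∈ D ∧ w ∈ transitions U V r Q ∧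
      Central D w Q} ⊆ D) hQ
    rwa [hD.isClosed.closure_eq] at this
  rw [mem_closure_iff_frequently] at hQ
  have h1 := hD.eventually_mem_transitions_iff hr hU hV hQD w
  rw [eventually_nhdsWithin_iff] at h1
  obtain ⟨Q₁, ⟨h2, h3, -⟩, h4⟩ := (hQ.and_eventually h1).exists
  have hw := (h4 h2).1 h3
  have hw1 := hD.om_mul_mem_transitions hr hU hV hQD hw
  have hw2 := hD.sub_om_mul_mem_transitions hr hU hV hQD hw
  have h5 := (hD.eventually_sameSide_iff hr hU hV hQD hw hw1).and
    (hD.eventually_sameSide_iff hr hU hV hQD hw hw2)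
  rw [eventually_nhdsWithin_iff] at h5
  obtain ⟨Q₂, ⟨h6, -, h7⟩, h8⟩ := (hQ.and_eventually h5).exists
  exact ⟨hQD, hw, (h8 h6).1.1 h7.1, (h8 h6).2.1 h7.2⟩

theorem central_along (hD : PolygonalInterface D U V) (hr : 0 < r)
    (hU : AvoidsEquilateral U r) (hV : AvoidsEquilateral V r) {S : Set ℝ} {H : ℝ → ℂ} {x y : ℝ}
    (hS : IsPreconnected S) (hH : ContinuousOn H S) (hHD : Set.MapsTo H S D) (hx : x ∈ S)
    (hy : y ∈ S) (hw : w ∈ transitions U V r (H x)) (h : Central D w (H x)) :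
    Central D w (H y) :=
  ⟨hD.sameSide_along hr hU hV hS hH hHD hx hy hw
      (hD.om_mul_mem_transitions hr hU hV (hHD hx) hw) h.1,
    hD.sameSide_along hr hU hV hS hH hHD hx hy hw
      (hD.sub_om_mul_mem_transitions hr hU hV (hHD hx) hw) h.2⟩

/-- An arc of length at most `L` ends at a central point of the ball of radius `2 / r * L`. By
compactness one step `δ` works at all those points, so finitely many extensions reach `L`. -/
theorem hasArc (hD : PolygonalInterface D U V) (hr : 0 < r)
    (hU : AvoidsEquilateral U r) (hV : AvoidsEquilateral V r) (hP : P ∈ D)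
    (hw : w ∈ transitions U V r P) (hc : Central D w P) {L : ℝ} (hL : 0 ≤ L) :
    HasArc D w (2 / r) P L := by
  have hK : 0 < 2 / r := by positivity
  set G := {Q | Q ∈ D ∧ w ∈ transitions U V r Q ∧ Central D w Q} with hG
  have hcomp : IsCompact (G ∩ Metric.closedBall P (2 / r * L)) :=
    (isCompact_closedBall _ _).inter_left (hD.isClosed_central hr hU hV w)
  obtain ⟨δ, hδ, hδG⟩ : ∃ δ > 0, ∀ Q ∈ G ∩ Metric.closedBall P (2 / r * L),
      HasArc D w (2 / r) Q δ := by
    refine hcomp.induction_on (p := fun S => ∃ δ > 0, ∀ Q ∈ S, HasArc D w (2 / r) Q δ)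
      ⟨1, one_pos, by simp⟩ ?_ ?_ ?_
    · rintro S T hST ⟨δ, hδ, h⟩
      exact ⟨δ, hδ, fun Q hQ => h Q (hST hQ)⟩
    · rintro S T ⟨δ, hδ, h⟩ ⟨δ', hδ', h'⟩
      refine ⟨min δ δ', lt_min hδ hδ', ?_⟩
      rintro Q (hQ | hQ)
      · exact (h Q hQ).mono (min_le_left _ _)
      · exact (h' Q hQ).mono (min_le_right _ _)
    · rintro Q ⟨⟨h1, h2, h3⟩, -⟩
      obtain ⟨δ, hδ, h⟩ := hD.exists_hasArc hr hU hV h1 h2 h3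
      have hsub : G ∩ Metric.closedBall P (2 / r * L) ⊆ D := fun z hz => hz.1.1
      exact ⟨_, nhdsWithin_mono Q hsub h, δ, hδ, fun Q hQ => hQ⟩
  have step : ∀ l, 0 ≤ l → l ≤ L → HasArc D w (2 / r) P l → HasArc D w (2 / r) P (l + δ) := by
    rintro l hl hlL ⟨H, hH, hH0, h⟩
    have hmaps : Set.MapsTo H (Set.Icc 0 l) D := fun x hx => (h x hx).1
    have h0 : (0 : ℝ) ∈ Set.Icc 0 l := ⟨le_rfl, hl⟩
    have hl' : l ∈ Set.Icc 0 l := ⟨hl, le_rfl⟩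
    obtain ⟨h1, h2, h3⟩ := h l hl'
    have hmem : H l ∈ G ∩ Metric.closedBall P (2 / r * L) := by
      refine ⟨⟨h1, hD.mem_transitions_along hr hU hV isPreconnected_Icc hH.continuousOn hmaps h0
        hl' (hH0.symm ▸ hw), hD.central_along hr hU hV isPreconnected_Icc hH.continuousOn hmaps h0
        hl' (hH0.symm ▸ hw) (hH0.symm ▸ hc)⟩, ?_⟩
      rw [Metric.mem_closedBall, dist_eq_norm]
      exact h3.trans (mul_le_mul_of_nonneg_left hlL hK.le)
    obtain ⟨H', hH', hH'0, h'⟩ := hδG _ hmem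
    refine ⟨fun x => if x ≤ l then H x else H' (x - l), ?_, by simp [hl, hH0], ?_⟩
    · refine Continuous.if_le hH (hH'.comp (by fun_prop)) continuous_id continuous_const ?_
      rintro x rfl
      simp [hH'0]
    · rintro x ⟨hx0, hx⟩
      by_cases hxl : x ≤ l
      · simp only [hxl, if_true]
        exact h x ⟨hx0, hxl⟩
      · simp only [hxl, if_false]
        push Not at hxl
        obtain ⟨h4, h5, h6⟩ := h' (x - l) ⟨by linarith, by linarith⟩
        refine ⟨h4, by rw [h5, h2]; ring, ?_⟩
        have h7 := norm_add_le (H' (x - l) - H l) (H l - P)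
        rw [sub_add_sub_cancel] at h7
        nlinarith
  have ind : ∀ n : ℕ, HasArc D w (2 / r) P (min (n * δ) L) := by
    intro n
    induction n with
    | zero =>
      refine ⟨fun _ => P, continuous_const, rfl, fun x hx => ?_⟩
      have hx0 : x = 0 := le_antisymm (hx.2.trans (by simp)) hx.1
      simp [hx0, hP]
    | succ n ih =>
      refine (step _ (le_min (by positivity) hL) (min_le_right _ _) ih).mono ?_
      push_cast
      rcases le_total (n * δ) L with h1 | h1
      · rw [min_eq_left h1]
        exact (min_le_left _ _).trans (by linarith)
      · rw [min_eq_right h1]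
        exact (min_le_right _ _).trans (by linarith)
  obtain ⟨n, hn⟩ := exists_nat_ge (L / δ)
  have := ind n
  rwa [min_eq_right ((div_le_iff₀ hδ).1 hn)] at this

theorem neg_central (h : Central D w P) : Central D (-w) P := by
  refine ⟨fun e he => ?_, fun e he => ?_⟩
  · have := h.1 e he
    have h2 : om * -w = -(om * w) := by ring
    rwa [h2, neg_dot, neg_dot, neg_mul_neg]
  · have := h.2 e he
    have h2 : -w - om * -w = -(w - om * w) := by ring
    rwa [h2, neg_dot, neg_dot, neg_mul_neg]

/-- Through every point of the interface there is a bi-infinite curve in the interface. -/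
theorem exists_isCurve (hD : PolygonalInterface D U V) (hr : 0 < r)
    (hU : AvoidsEquilateral U r) (hV : AvoidsEquilateral V r) (hP : P ∈ D)
    (hw : w ∈ transitions U V r P) (hc : Central D w P) : ∃ H, IsCurve D w H ∧ H 0 = P := by
  have hex : ∀ n : ℕ, ∃ H : ℝ → ℂ, Continuous H ∧ H 0 = P ∧ ∀ x ∈ Set.Icc (-n : ℝ) n,
      H x ∈ D ∧ dot w (H x) = dot w P + x := by
    intro n
    obtain ⟨H, hH, hH0, h⟩ := hD.hasArc hr hU hV hP hw hc (Nat.cast_nonneg n)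
    obtain ⟨H', hH', hH'0, h'⟩ := hD.hasArc hr hU hV hP (hD.neg_mem_transitions hr hU hV hP hw)
      (neg_central hc) (Nat.cast_nonneg n)
    refine ⟨fun x => if 0 ≤ x then H x else H' (-x), ?_, by simp [hH0], ?_⟩
    · refine Continuous.if_le hH (hH'.comp continuous_neg) continuous_const continuous_id ?_
      rintro x rfl
      simp [hH0, hH'0]
    · rintro x ⟨hx, hx'⟩
      by_cases h0 : 0 ≤ x
      · simp only [h0, if_true]
        exact ⟨(h x ⟨h0, hx'⟩).1, (h x ⟨h0, hx'⟩).2.1⟩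
      · simp only [h0, if_false]
        push Not at h0
        obtain ⟨h1, h2, -⟩ := h' (-x) ⟨by linarith, by linarith⟩
        rw [neg_dot, neg_dot] at h2
        exact ⟨h1, by linarith⟩
  choose F hF hF0 hFD using hex
  have hagree : ∀ {m n : ℕ} {x : ℝ}, m ≤ n → |x| ≤ m → F m x = F n x := by
    intro m n x hmn hx
    have hmn' : (m : ℝ) ≤ n := by exact_mod_cast hmn
    have hn : ∀ y ∈ Set.Icc (-m : ℝ) m, y ∈ Set.Icc (-n : ℝ) n := fun y hy =>
      ⟨by linarith [hy.1], hy.2.trans hmn'⟩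
    have hm0 : (0 : ℝ) ∈ Set.Icc (-m : ℝ) m := ⟨by simp, by simp⟩
    have hmaps : Set.MapsTo (F m) (Set.Icc (-m : ℝ) m) D := fun y hy => (hFD m y hy).1
    refine hD.eqOn_of_dot_eq (w := w) isPreconnected_Icc (hF m).continuousOn
      (hF n).continuousOn hmaps (fun y hy => (hFD n y (hn y hy)).1)
      (fun y hy => ?_) hm0 (by rw [hF0, hF0]) (fun y hy => ?_) (abs_le.1 hx)
    · rw [(hFD m y hy).2, (hFD n y (hn y hy)).2]
    · obtain ⟨e, f, h1, -, h2, h3⟩ := hD.exists_dirs_eq hr hU hV (hmaps hy)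
        (hD.mem_transitions_along hr hU hV isPreconnected_Icc (hF m).continuousOn hmaps hm0 hy
          (by rw [hF0]; exact hw))
      exact ⟨e, f, h1, h2, h3⟩
  -- The arcs agree on overlaps, so near `x` the glued curve is the single arc with index `⌈|x|⌉₊ +
  -- 1`; this gives continuity.
  set H : ℝ → ℂ := fun x => F ⌈|x|⌉₊ x with hH
  have hHF : ∀ {n : ℕ} {x : ℝ}, |x| ≤ n → H x = F n x := fun {n x} hx =>
    hagree (Nat.ceil_le.2 hx) (Nat.le_ceil _)
  have hH0 : H 0 = P := hF0 _
  have hmem : ∀ x, x ∈ Set.Icc (-(⌈|x|⌉₊ : ℝ)) ⌈|x|⌉₊ := fun x => abs_le.1 (Nat.le_ceil _)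
  refine ⟨H, ⟨continuous_iff_continuousAt.2 fun x => ?_, fun x => (hFD _ x (hmem x)).1,
    fun x => ?_⟩, hH0⟩
  · have hev : ∀ᶠ y in 𝓝 x, F (⌈|x|⌉₊ + 1) y = H y := by
      have hc : ContinuousAt (fun y : ℝ => |y|) x := by fun_prop
      have hlt : |x| < ((⌈|x|⌉₊ + 1 : ℕ) : ℝ) := by
        push_cast; linarith [Nat.le_ceil |x|]
      filter_upwards [hc.tendsto.eventually_lt_const hlt] with y hy using (hHF hy.le).symm
    exact (hF _).continuousAt.congr hev
  · rw [hH0]; exact (hFD _ x (hmem x)).2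

end PolygonalInterface

/-! ### Monotonicity, translations and the period -/

/-- The vectors by which the curve `H` can be translated within `D`, with the same rays of `D` at
corresponding points. -/
def translations (D : Set ℂ) (H : ℝ → ℂ) : Set ℂ := {u | ∀ x, dirs D (H x + u) = dirs D (H x)}

/-- The line of `e` is at an angle of less than π/6 from `w`, and `z` at most π/3 from `w`; together
this stays below a right angle. -/
theorem dot_mul_dot_pos_of_cone {w z e : ℂ} (h1 : 0 < dot w e * dot (om * w) e)
    (h2 : 0 < dot w e * dot (w - om * w) e) (hz : 0 < dot w z)
    (hc : cross w z ^ 2 ≤ 3 * dot w z ^ 2) : 0 < dot w e * dot z e := by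
  have hs : √3 * √3 = 3 := Real.mul_self_sqrt (by norm_num)
  have h3 : dot (w - om * w) e = dot w e / 2 - √3 / 2 * cross w e := by
    simp [dot, cross]; ring
  rw [dot_om_mul] at h1
  rw [h3] at h2
  have h5 : 0 < dot w e ^ 2 := by
    have : dot w e ≠ 0 := fun h => by simp [h] at h1
    positivity
  have h6 : 3 * cross w e ^ 2 < dot w e ^ 2 := by
    have := mul_pos h1 h2
    have h7 : dot w e * (dot w e / 2 + √3 / 2 * cross w e) *
        (dot w e * (dot w e / 2 - √3 / 2 * cross w e)) =
        dot w e ^ 2 * (dot w e ^ 2 / 4 - (√3 * √3) / 4 * cross w e ^ 2) := by ring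
    rw [h7, hs] at this
    have := (mul_pos_iff_of_pos_left h5).1 this
    linarith
  have h7 : ‖w‖ ^ 2 * dot z e = dot w z * dot w e + cross w z * cross w e := by
    rw [← dot_self]; simp only [dot, cross]; ring
  have h8 : (cross w z * cross w e) ^ 2 < (dot w z * dot w e) ^ 2 := by
    have := pow_pos hz 2
    nlinarith [sq_nonneg (cross w e)]
  have h9 := sq_lt_sq.1 h8
  have h10 : 0 < ‖w‖ ^ 2 * (dot w e * dot z e) := by
    have h11 : ‖w‖ ^ 2 * (dot w e * dot z e) =
      dot w e * (dot w z * dot w e + cross w z * cross w e) := by rw [← h7]; ring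
    rw [h11]
    have hd : dot w e ≠ 0 := fun h => by simp [h] at h5
    rcases lt_or_gt_of_ne hd with h | h
    · apply mul_pos_of_neg_of_neg h
      rw [abs_of_neg (mul_neg_of_pos_of_neg hz h)] at h9
      linarith [le_abs_self (cross w z * cross w e)]
    · apply mul_pos h
      rw [abs_of_pos (mul_pos hz h)] at h9
      linarith [neg_abs_le (cross w z * cross w e)]
  exact pos_of_mul_pos_right h10 (by positivity)

theorem SameSide.trans {D : Set ℂ} {w v s Q : ℂ} (h1 : SameSide D w v Q)
    (h2 : SameSide D w s Q) : SameSide D v s Q := by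
  intro e he
  have h3 := mul_pos (h1 e he) (h2 e he)
  have h4 : dot w e * dot v e * (dot w e * dot s e) =
    dot w e ^ 2 * (dot v e * dot s e) := by ring
  rw [h4] at h3
  exact pos_of_mul_pos_right h3 (by positivity)

theorem dot_le_mul_norm (w z : ℂ) : dot w z ≤ ‖w‖ * ‖z‖ := by
  have h := dot_sq_add_cross_sq w z
  have : dot w z ^ 2 ≤ (‖w‖ * ‖z‖) ^ 2 := by nlinarith [sq_nonneg (cross w z)]
  exact (le_abs_self _).trans (abs_le_of_sq_le_sq this (by positivity))

namespace PolygonalInterface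

variable {D U V : Set ℂ} {r : ℝ} {P Q w s u u' v : ℂ} {H : ℝ → ℂ}

/-- Locally the curve moves forward along a ray that has positive product with `w`, hence with `s`.
So `dot s` cannot attain its maximum over an interval before the right end. -/
theorem monotone_dot (hD : PolygonalInterface D U V) (hH : IsCurve D w H)
    (hs : ∀ x, SameSide D w s (H x)) : Monotone fun x => dot s (H x) := by
  intro x y hxy
  have hcont : ContinuousOn (fun x => dot s (H x)) (Set.Icc x y) :=
    ((continuous_dot s).comp hH.continuous).continuousOn
  obtain ⟨z, hz, hmax⟩ := isCompact_Icc.exists_isMaxOn ⟨x, Set.left_mem_Icc.2 hxy⟩ hcont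
  have hzy : z = y := by
    by_contra hne
    have hlt : z < y := lt_of_le_of_ne hz.2 hne
    obtain ⟨ε, hε, h⟩ := hD.exists_radius_mem (H z)
    have h1 : ∀ᶠ t in 𝓝[>] z, H t ∈ Metric.ball (H z) ε :=
      nhdsWithin_le_nhds (hH.continuous.continuousAt.eventually (Metric.ball_mem_nhds _ hε))
    have h2 : ∀ᶠ t in 𝓝[>] z, t < y := nhdsWithin_le_nhds (Iio_mem_nhds hlt)
    obtain ⟨t, ht1, ht2, ht3⟩ := (h1.and (h2.and self_mem_nhdsWithin)).exists
    have ht3' : z < t := ht3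
    rw [Metric.mem_ball, dist_eq_norm] at ht1
    have hd : dot w (H t) - dot w (H z) = t - z := by rw [hH.dot_eq t, hH.dot_eq z]; ring
    rcases h (H t) (hH.mem t) ht1 with h3 | ⟨e, he, l, hl, -, hle, -⟩
    · rw [h3] at hd; linarith
    · have h4 : dot w (H t) - dot w (H z) = l * dot w e := by
        rw [hle, dot_add, dot_real_mul]; ring
      have h5 : dot s (H t) = dot s (H z) + l * dot s e := by rw [hle, dot_add, dot_real_mul]
      have h6 : 0 < dot w e := by
        have : 0 < l * dot w e := by linarith
        exact pos_of_mul_pos_right this hl.le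
      have h7 : 0 < dot s e := pos_of_mul_pos_right (hs z e he) h6.le
      have h8 : dot s (H t) ≤ dot s (H z) := hmax ⟨hz.1.trans ht3'.le, ht2.le⟩
      have := mul_pos hl h7
      linarith
  have := hmax (Set.left_mem_Icc.2 hxy)
  rwa [hzy] at this

/-- Either `s` or `-s` is on the side of `w`, all along the curve; with `-s`, monotonicity would
contradict the positive displacement. -/
theorem sameSide_of_dot_pos (hD : PolygonalInterface D U V) (hr : 0 < r)
    (hU : AvoidsEquilateral U r) (hV : AvoidsEquilateral V r) (hH : IsCurve D w H)
    (hw : w ∈ transitions U V r (H 0)) (hs : s ∈ transitions U V r (H 0)) {y : ℝ} (hy : 0 ≤ y)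
    (hpos : 0 < dot s (H y - H 0)) (x : ℝ) : SameSide D w s (H x) := by
  have along : ∀ {s : ℂ}, s ∈ transitions U V r (H 0) → SameSide D w s (H 0) →
      ∀ x, SameSide D w s (H x) := fun hs h x =>
    hD.sameSide_along hr hU hV isPreconnected_univ hH.continuous.continuousOn
      (fun y _ => hH.mem y) (Set.mem_univ 0) (Set.mem_univ x) hw hs h
  obtain ⟨e, he⟩ := hD.dirs_nonempty _ (hH.mem 0)
  have h1 := hD.dot_ne_zero hr hU hV (hH.mem 0) hw he
  have h2 := hD.dot_ne_zero hr hU hV (hH.mem 0) hs he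
  rcases lt_or_gt_of_ne (mul_ne_zero h1 h2) with h | h
  · exfalso
    have hs' := hD.neg_mem_transitions hr hU hV (hH.mem 0) hs
    have h3 := hD.sameSide_of_mem hr hU hV (hH.mem 0) hw hs' he (by rw [neg_dot]; linarith)
    have h4 := hD.monotone_dot hH (along hs' h3) hy
    simp only [neg_dot] at h4
    rw [dot_sub] at hpos
    linarith
  · exact along hs (hD.sameSide_of_mem hr hU hV (hH.mem 0) hw hs he h) x

theorem mem_translations (hD : PolygonalInterface D U V) (hr : 0 < r)
    (hU : AvoidsEquilateral U r) (hV : AvoidsEquilateral V r) (hH : IsCurve D w H)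
    (hu : u ∈ transitions U V r (H 0)) : u ∈ translations D H := by
  intro x
  have hu' : u ∈ transitions U V r (H x) :=
    hD.mem_transitions_along hr hU hV isPreconnected_univ hH.continuous.continuousOn
      (fun y _ => hH.mem y) (Set.mem_univ 0) (Set.mem_univ x) hu
  obtain ⟨e, f, h1, h2, -⟩ := hD.exists_dirs_eq hr hU hV (hH.mem x) hu'
  rw [h1, h2]

theorem add_mem (hD : PolygonalInterface D U V) (hH : IsCurve D w H)
    (hu : u ∈ translations D H) (x : ℝ) : H x + u ∈ D := by
  obtain ⟨e, he⟩ := hD.dirs_nonempty _ (hH.mem x)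
  exact hD.mem_of_dirs_nonempty (e := e) (by rw [hu x]; exact he)

/-- Translates of `H` within the interface that have a common point differ by a
reparametrization. -/
theorem add_eq_add (hD : PolygonalInterface D U V) (hr : 0 < r)
    (hU : AvoidsEquilateral U r) (hV : AvoidsEquilateral V r) (hH : IsCurve D w H)
    (hw : w ∈ transitions U V r (H 0)) (hu : u ∈ translations D H)
    (hu' : u' ∈ translations D H) {x : ℝ} (h : H x + u = H 0 + u') (y : ℝ) :
    H (x + y) + u = H y + u' := by
  have hc := hH.continuous
  refine hD.eqOn_of_dot_eq (w := w) (α := fun y => H (x + y) + u) (β := fun y => H y + u')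
    isPreconnected_univ (x := 0) (by fun_prop) (by fun_prop) (fun y _ => hD.add_mem hH hu _)
    (fun y _ => hD.add_mem hH hu' _) (fun y _ => ?_) (Set.mem_univ 0) (by simpa using h)
    (fun y _ => ?_) (Set.mem_univ y)
  · have h1 := congrArg (dot w) h
    rw [dot_add, dot_add, hH.dot_eq x] at h1
    rw [dot_add, dot_add, hH.dot_eq (x + y), hH.dot_eq y]
    linarith
  · obtain ⟨e, f, h1, -, h2, h3⟩ := hD.exists_dirs_eq hr hU hV (hH.mem (x + y))
      (hD.mem_transitions_along hr hU hV isPreconnected_univ hH.continuous.continuousOn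
      (fun y _ => hH.mem y) (Set.mem_univ 0) (Set.mem_univ (x + y)) hw)
    exact ⟨e, f, by rw [hu (x + y), h1], h2, h3⟩

/-- A bi-infinite curve in the interface that is invariant under the translation by `v`, all of
whose rays make an angle of less than `π / 6` with `v`. -/
structure IsPeriodicCurve (D U V : Set ℂ) (r : ℝ) (w v : ℂ) (T : ℝ) (H : ℝ → ℂ) : Prop where
  isCurve : IsCurve D w H
  mem_transitions : w ∈ transitions U V r (H 0)
  period_mem : v ∈ transitions U V r (H 0)
  pos : 0 < T
  add_period : ∀ x, H (x + T) = H x + v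
  central : ∀ x, Central D v (H x)
  monotone_left : Monotone fun x => dot (om * v) (H x)
  monotone_right : Monotone fun x => dot (v - om * v) (H x)

/-- The chord `v` from `H 0` to a later point `H T` at distance `r` is a color change, because the
rays at `H T` straddle its normal. Then `H` and its translate by `v` are curves in the interface
through the same point, so they coincide up to the parameter shift `T`. -/
theorem exists_isPeriodicCurve (hD : PolygonalInterface D U V) (hr : 0 < r)
    (hU : AvoidsEquilateral U r) (hV : AvoidsEquilateral V r) (hP : P ∈ D) :
    ∃ w v T H, IsPeriodicCurve D U V r w v T H ∧ H 0 = P := by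
  obtain ⟨w, hw, hc⟩ := hD.exists_central hr hU hV hP
  obtain ⟨H, hH, rfl⟩ := hD.exists_isCurve hr hU hV hP hw hc
  have hwn : ‖w‖ = r := hw.1
  have hcentral : ∀ x, Central D w (H x) := fun x =>
    hD.central_along hr hU hV isPreconnected_univ hH.continuous.continuousOn
      (fun y _ => hH.mem y) (Set.mem_univ 0) (Set.mem_univ x) hw hc
  have hcont := hH.continuous
  -- At parameter `r ^ 2` the `w`-coordinate has grown by `r ^ 2 = ‖w‖ * r`, so the distance from `H
  -- 0` is at least `r`.
  obtain ⟨T, ⟨hT0, -⟩, hT⟩ : r ∈ (fun x => ‖H x - H 0‖) '' Set.Icc 0 (r ^ 2) := by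
    refine intermediate_value_Icc (by positivity) (by fun_prop) ⟨by simpa using hr.le, ?_⟩
    have h1 := dot_le_mul_norm w (H (r ^ 2) - H 0)
    rw [dot_sub, hH.dot_eq (r ^ 2), hwn, add_sub_cancel_left] at h1
    exact le_of_mul_le_mul_left (by rwa [← sq]) hr
  have hTpos : 0 < T := lt_of_le_of_ne hT0 fun h => by simp [← h] at hT; linarith
  set v := H T - H 0 with hv
  have hvn : ‖v‖ = r := hT
  have hHT : H 0 + v = H T := by rw [hv]; ring
  have hdv : dot w v = T := by rw [hv, dot_sub, hH.dot_eq T]; ring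
  have hvt : v ∈ transitions U V r (H 0) := by
    have h1 := hD.monotone_dot hH (fun x => (hcentral x).1) hT0
    have h2 := hD.monotone_dot hH (fun x => (hcentral x).2) hT0
    have h1' : 0 ≤ dot (om * w) v := by rw [hv, dot_sub]; exact sub_nonneg.2 h1
    have h2' : 0 ≤ dot (w - om * w) v := by rw [hv, dot_sub]; exact sub_nonneg.2 h2
    have h3 : dot (w - om * w) v = dot w v / 2 - √3 / 2 * cross w v := by
      simp [dot, cross]; ring
    rw [dot_om_mul] at h1'
    rw [h3] at h2'
    have hs : √3 * √3 = 3 := Real.mul_self_sqrt (by norm_num)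
    -- Monotonicity in the two directions at ±π/3 from `w` bounds the angle between `v` and `w` by
    -- π/6, within the π/3 required by `dot_mul_dot_pos_of_cone`.
    have h4 : cross w v ^ 2 ≤ 3 * dot w v ^ 2 := by
      have := mul_nonneg h1' h2'
      nlinarith [sq_nonneg (dot w v)]
    obtain ⟨e, f, hef, -, he, hf⟩ := hD.exists_dirs_eq hr hU hV (hH.mem T)
      (hD.mem_transitions_along hr hU hV isPreconnected_univ hH.continuous.continuousOn
      (fun y _ => hH.mem y) (Set.mem_univ 0) (Set.mem_univ T) hw)
    have hce : ∀ g ∈ dirs D (H T), 0 < dot w g * dot v g := fun g hg =>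
      dot_mul_dot_pos_of_cone ((hcentral T).1 g hg) ((hcentral T).2 g hg)
        (by rw [hdv]; exact hTpos) h4
    refine hD.mem_transitions_of_mul_neg hvn hr (by rw [hHT]; exact hef) ?_
    have h5 := pos_of_mul_pos_right (hce e (by rw [hef]; simp)) he.le
    have h6 := hce f (by rw [hef]; simp)
    exact mul_neg_of_pos_of_neg h5 (by nlinarith)
  have hvv : dot v v = r ^ 2 := by rw [dot_self, hvn]
  have hr2 : 0 < r ^ 2 := by positivity
  have hcvv : cross v v = 0 := by simp [cross]; ring
  have ho : dot (om * v) v = r ^ 2 / 2 := by rw [dot_om_mul, hvv, hcvv]; ring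
  have ho' : dot (v - om * v) v = r ^ 2 / 2 := by
    have : dot (v - om * v) v = dot v v - dot (om * v) v := by simp [dot]; ring
    rw [this, ho, hvv]; ring
  -- The displacement `v` has positive product with `v` and with both its rotations by ±π/3, which
  -- makes `v` itself central.
  have hs0 := hD.sameSide_of_dot_pos hr hU hV hH hw hvt hT0 (by rw [← hv, hvv]; exact hr2)
  have hs1 := hD.sameSide_of_dot_pos hr hU hV hH hw
    (hD.om_mul_mem_transitions hr hU hV hP hvt) hT0 (by rw [← hv, ho]; linarith)
  have hs2 := hD.sameSide_of_dot_pos hr hU hV hH hw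
    (hD.sub_om_mul_mem_transitions hr hU hV hP hvt) hT0 (by rw [← hv, ho']; linarith)
  refine ⟨w, v, T, H, ⟨hH, hw, hvt, hTpos, fun x => ?_, fun x => ⟨(hs0 x).trans (hs1 x),
    (hs0 x).trans (hs2 x)⟩, hD.monotone_dot hH hs1, hD.monotone_dot hH hs2⟩, rfl⟩
  have := hD.add_eq_add hr hU hV hH hw (u := 0) (u' := v) (x := T) (fun x => by simp)
    (hD.mem_translations hr hU hV hH hvt) (by rw [add_zero, hHT]) x
  rwa [add_zero, add_comm] at this

end PolygonalInterface

/-! ### Heights of translations and the descent -/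

/-- If `x + p < B / 2`, then `p < 0.6 * B`, so `|q| ≤ 0.347 * B`, while `|y| ≤ 0.434 * B`. The
squared length is then at most `(0.5 ^ 2 + 0.781 ^ 2) * B ^ 2`, less than `B ^ 2`. -/
theorem half_le_of_norm_eq {B x y p q : ℝ} (hB : 0 < B) (hx : -(B / 10) ≤ x)
    (hy : y ^ 2 ≤ 3 / 16 * B ^ 2) (hp : 0 ≤ p) (hq : q ^ 2 ≤ p ^ 2 / 3)
    (h : (x + p) ^ 2 + (y + q) ^ 2 = B * B) : B / 2 ≤ x + p := by
  by_contra! hlt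
  have hB2 := pow_pos hB 2
  have h1 : p < 6 / 10 * B := by linarith
  have h1' : p ^ 2 ≤ (6 / 10 * B) ^ 2 := pow_le_pow_left₀ hp h1.le 2
  have h2 : |y| ≤ 434 / 1000 * B := by
    apply abs_le_of_sq_le_sq _ (by positivity)
    rw [mul_pow]; linarith
  have h3 : |q| ≤ 347 / 1000 * B := by
    apply abs_le_of_sq_le_sq _ (by positivity)
    rw [mul_pow] at h1' ⊢; linarith
  have h4 : |y + q| ≤ 781 / 1000 * B := (abs_add_le _ _).trans (by linarith)
  have h5 : (y + q) ^ 2 ≤ (781 / 1000 * B) ^ 2 := by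
    rw [← sq_abs]; exact pow_le_pow_left₀ (abs_nonneg _) h4 2
  have h6 : |x + p| ≤ B / 2 := abs_le.2 ⟨by linarith, hlt.le⟩
  have h7 : (x + p) ^ 2 ≤ (B / 2) ^ 2 := by
    rw [← sq_abs]; exact pow_le_pow_left₀ (abs_nonneg _) h6 2
  rw [mul_pow] at h5
  rw [div_pow] at h7
  rw [← sq] at h
  linarith

/-- Rotating a vector with small imaginary part `y` and real part `x` by `π / 3` and subtracting
`exp (π i / 3) * B` decreases the imaginary part. -/
theorem height_descent {B x y : ℝ} (hy0 : 0 < y) (hy : y ≤ √3 / 4 * B)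
    (h : x ^ 2 + y ^ 2 = B * B) (hB : 0 < B) (hx0 : 0 ≤ x) :
    0 < y / 2 + √3 / 2 * x - √3 / 2 * B ∧ y / 2 + √3 / 2 * x - √3 / 2 * B < y := by
  have hs : √3 * √3 = 3 := Real.mul_self_sqrt (by norm_num)
  have hs0 : 0 < √3 := Real.sqrt_pos.2 (by norm_num)
  have h1 : y ^ 2 ≤ 3 / 16 * B ^ 2 := by
    have h1 := pow_le_pow_left₀ hy0.le hy 2
    have h2 : (√3 / 4 * B) ^ 2 = (√3 * √3) / 16 * B ^ 2 := by ring
    rwa [h2, hs] at h1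
  have h2 : x < B := by nlinarith [pow_pos hy0 2]
  have h3 : B / 2 < x := by nlinarith
  -- Since `y ^ 2 = (B - x) * (B + x)`, this amounts to `B / 2 < x`.
  have h4 : (√3 * (B - x)) ^ 2 < y ^ 2 := by
    have : (√3 * (B - x)) ^ 2 = (√3 * √3) * (B - x) ^ 2 := by ring
    rw [this, hs]; nlinarith
  have h5 := lt_of_pow_lt_pow_left₀ 2 hy0.le h4
  have h6 : 0 < √3 * (B - x) := mul_pos hs0 (by linarith)
  constructor <;> linarith

namespace PolygonalInterface

variable {D U V : Set ℂ} {a b r T : ℝ} {P Q w s u u' v : ℂ} {H : ℝ → ℂ}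

/-- Translations can be composed with the six rotated copies of the period. -/
theorem add_mem_translations (hD : PolygonalInterface D U V) (hr : 0 < r)
    (hU : AvoidsEquilateral U r) (hV : AvoidsEquilateral V r)
    (hH : IsPeriodicCurve D U V r w v T H) (hu : u ∈ translations D H) :
    u + v ∈ translations D H ∧ u - v ∈ translations D H ∧ u + om * v ∈ translations D H ∧
      u - om * v ∈ translations D H := by
  have hv := hD.mem_translations hr hU hV hH.isCurve hH.period_mem
  have hmem := hD.add_mem hH.isCurve hu
  -- By periodicity the translate of the curve by `u` has at `H x + u + v` the rays of `H x`, which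
  -- straddle the normal of `v`.
  have htr : ∀ x, v ∈ transitions U V r (H x + u) := by
    intro x
    have h1 : v ∈ transitions U V r (H x) :=
      hD.mem_transitions_along hr hU hV isPreconnected_univ hH.isCurve.continuous.continuousOn
        (fun y _ => hH.isCurve.mem y) (Set.mem_univ 0) (Set.mem_univ x) hH.period_mem
    obtain ⟨e, f, h2, -, h3, h4⟩ := hD.exists_dirs_eq hr hU hV (hH.isCurve.mem x) h1
    refine hD.mem_transitions_of_mul_neg h1.1 hr (e := e) (f := f) ?_
      (mul_neg_of_pos_of_neg h3 h4)
    rw [add_right_comm, ← hH.add_period, hu, hH.add_period, hv x, h2]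
  have key : ∀ s : ℂ, (∀ x, s ∈ transitions U V r (H x + u)) → u + s ∈ translations D H := by
    intro s hs x
    obtain ⟨e, f, h1, h2, -⟩ := hD.exists_dirs_eq hr hU hV (hmem x) (hs x)
    rw [← add_assoc, h2, ← h1, hu x]
  refine ⟨key _ htr, ?_, key _ fun x => hD.om_mul_mem_transitions hr hU hV (hmem x) (htr x), ?_⟩
  · rw [sub_eq_add_neg]
    exact key _ fun x => hD.neg_mem_transitions hr hU hV (hmem x) (htr x)
  · rw [sub_eq_add_neg]
    exact key _ fun x => hD.neg_mem_transitions hr hU hV (hmem x)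
      (hD.om_mul_mem_transitions hr hU hV (hmem x) (htr x))

theorem add_int_mul_mem_translations (hD : PolygonalInterface D U V) (hr : 0 < r)
    (hU : AvoidsEquilateral U r) (hV : AvoidsEquilateral V r)
    (hH : IsPeriodicCurve D U V r w v T H) (hu : u ∈ translations D H) (n : ℤ) :
    u + n * v ∈ translations D H := by
  induction n with
  | zero => simpa using hu
  | succ n ih =>
    convert (hD.add_mem_translations hr hU hV hH ih).1 using 1
    push_cast; ring
  | pred n ih =>
    convert (hD.add_mem_translations hr hU hV hH ih).2.1 using 1
    push_cast; ring

/-- Translations of `H` into itself are parallel to its period. -/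
theorem cross_eq_of_add_eq_add (hD : PolygonalInterface D U V) (hr : 0 < r)
    (hU : AvoidsEquilateral U r) (hV : AvoidsEquilateral V r)
    (hH : IsPeriodicCurve D U V r w v T H) (hu : u ∈ translations D H)
    (hu' : u' ∈ translations D H) {x : ℝ} (h : H x + u = H 0 + u') : cross v u = cross v u' := by
  have hadd : ∀ y z, cross v (y + z) = cross v y + cross v z := by
    intro y z; simp [cross]; ring
  have hvv : cross v v = 0 := by simp [cross]; ring
  have hper : Function.Periodic (fun x => cross v (H x)) T := fun x => by
    simp only [hH.add_period, hadd, hvv, add_zero]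
  have hbdd := hper.isBounded_of_continuous hH.pos.ne'
    ((continuous_cross v).comp hH.isCurve.continuous)
  obtain ⟨M, hM⟩ := hbdd.exists_norm_le
  have hshift : ∀ y, cross v (H (x + y)) = cross v (H y) + (cross v u' - cross v u) := by
    intro y
    have := congrArg (cross v) (hD.add_eq_add hr hU hV hH.isCurve hH.mem_transitions hu hu' h y)
    rw [hadd, hadd] at this
    linarith
  -- A translation of the curve into itself that changed the height could be iterated, and the
  -- height would grow without bound, whereas it is periodic along the curve.
  have hn : ∀ n : ℕ, cross v (H (n * x)) = cross v (H 0) + n * (cross v u' - cross v u) := by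
    intro n
    induction n with
    | zero => simp
    | succ n ih =>
      have : ((n + 1 : ℕ) : ℝ) * x = x + n * x := by push_cast; ring
      rw [this, hshift, ih]; push_cast; ring
  by_contra hne
  have hd : 0 < |cross v u' - cross v u| := abs_pos.2 (sub_ne_zero.2 (Ne.symm hne))
  obtain ⟨n, hn'⟩ := exists_nat_gt (2 * M / |cross v u' - cross v u|)
  rw [div_lt_iff₀ hd] at hn'
  have h1 := hM _ ⟨n * x, rfl⟩
  have h2 := hM _ ⟨0, rfl⟩
  simp only [Real.norm_eq_abs] at h1 h2
  have h3 : (n : ℝ) * |cross v u' - cross v u| = |cross v (H (n * x)) - cross v (H 0)| := by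
    rw [hn n, add_sub_cancel_left, abs_mul, Nat.abs_cast]
  have h4 := abs_sub (cross v (H (n * x))) (cross v (H 0))
  linarith

/-- Every translation of small height is, up to a motion along the period, a transition vector. -/
theorem exists_transition_of_translation (hD : PolygonalInterface D U V) (hr : 0 < r)
    (hU : AvoidsEquilateral U r) (hV : AvoidsEquilateral V r)
    (hH : IsPeriodicCurve D U V r w v T H) (hu : u ∈ translations D H)
    (hpos : 0 < cross v u) (hle : cross v u ≤ √3 / 4 * r ^ 2) :
    ∃ u' ∈ transitions U V r (H 0), cross v u' = cross v u := by
  have hs : √3 * √3 = 3 := Real.mul_self_sqrt (by norm_num)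
  have hs0 : 0 ≤ √3 := Real.sqrt_nonneg 3
  have hvn : ‖v‖ = r := hH.period_mem.1
  set B := r ^ 2 with hB
  have hBpos : 0 < B := by positivity
  have hdadd : ∀ y z, dot v (y + z) = dot v y + dot v z := dot_add v
  have hcadd : ∀ y z, cross v (y + z) = cross v y + cross v z := by
    intro y z; simp [cross]; ring
  have hvv : dot v v = B := by rw [dot_self, hvn]
  have hcvv : cross v v = 0 := by simp [cross]; ring
  -- Multiples of `v` bring `dot v u₁` into `[-B / 10, 9 * B / 10)`. Then `u₁` is shorter than `r`,
  -- because 81/100 + 3/16 < 1, and hardly points backwards, as `half_le_of_norm_eq` requires.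
  set n : ℤ := -⌊dot v u / B + 1 / 10⌋ with hn
  set u₁ := u + n * v with hu₁
  have hu₁t : u₁ ∈ translations D H := hD.add_int_mul_mem_translations hr hU hV hH hu n
  have hnv : (n : ℂ) * v = ((n : ℝ) : ℂ) * v := by push_cast; rfl
  have hc₁ : cross v u₁ = cross v u := by
    rw [hu₁, hcadd, hnv, cross_real_mul, hcvv, mul_zero, add_zero]
  have hd₁ : dot v u₁ = (dot v u / B + n) * B := by
    rw [hu₁, hdadd, hnv, dot_real_mul, hvv]; field_simp
  have hnr : (n : ℝ) = -(⌊dot v u / B + 1 / 10⌋ : ℝ) := by rw [hn]; push_cast; rfl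
  have hlow : -(B / 10) ≤ dot v u₁ := by
    have := Int.floor_le (dot v u / B + 1 / 10)
    rw [hd₁]; nlinarith
  have hhigh : dot v u₁ < 9 / 10 * B := by
    have := Int.lt_floor_add_one (dot v u / B + 1 / 10)
    rw [hd₁]; nlinarith
  have hy2 : cross v u₁ ^ 2 ≤ 3 / 16 * B ^ 2 := by
    rw [hc₁]
    have h1 : cross v u ^ 2 ≤ (√3 / 4 * B) ^ 2 := pow_le_pow_left₀ hpos.le hle 2
    have h2 : (√3 / 4 * B) ^ 2 = (√3 * √3) / 16 * B ^ 2 := by ring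
    rwa [h2, hs] at h1
  have hstart : ‖u₁‖ < r := by
    have h1 := dot_sq_add_cross_sq v u₁
    rw [hvn] at h1
    have h2 : dot v u₁ ^ 2 ≤ 81 / 100 * B ^ 2 := by nlinarith
    have h3 : B * ‖u₁‖ ^ 2 < B * r ^ 2 := by nlinarith [pow_pos hBpos 2]
    exact lt_of_pow_lt_pow_left₀ 2 hr.le (lt_of_mul_lt_mul_left h3 hBpos.le)
  have hcont := hH.isCurve.continuous
  -- Advancing along the curve lengthens `u₁` to length `r`: at parameter `B + r * ‖u₁‖` the
  -- `w`-coordinate of the sum is at least `B = r * r`.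
  obtain ⟨x, ⟨hx0, -⟩, hx⟩ : r ∈ (fun x => ‖H x - H 0 + u₁‖) '' Set.Icc 0 (B + r * ‖u₁‖) := by
    refine intermediate_value_Icc (by positivity) (by fun_prop) ⟨by simpa using hstart.le, ?_⟩
    have hwn : ‖w‖ = r := hH.mem_transitions.1
    have h1 := dot_le_mul_norm w (H (B + r * ‖u₁‖) - H 0 + u₁)
    have h2 := dot_le_mul_norm w (-u₁)
    rw [dot_neg, norm_neg, hwn] at h2
    rw [dot_add, dot_sub, hH.isCurve.dot_eq (B + r * ‖u₁‖), hwn] at h1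
    have h3 : r * r ≤ r * ‖H (B + r * ‖u₁‖) - H 0 + u₁‖ := by rw [hB] at h1 ⊢; linarith
    exact le_of_mul_le_mul_left h3 hr
  set u' := H x - H 0 + u₁ with hu'
  have hu'n : ‖u'‖ = r := hx
  have hHu' : H x + u₁ = H 0 + u' := by rw [hu']; ring
  set c := H x - H 0 with hc
  have hcl : 0 ≤ dot v c / 2 + √3 / 2 * cross v c := by
    rw [← dot_om_mul, hc, dot_sub]; exact sub_nonneg.2 (hH.monotone_left hx0)
  have hcr : 0 ≤ dot v c / 2 - √3 / 2 * cross v c := by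
    have : dot v c / 2 - √3 / 2 * cross v c = dot (v - om * v) c := by simp [dot, cross]; ring
    rw [this, hc, dot_sub]; exact sub_nonneg.2 (hH.monotone_right hx0)
  have hc0 : 0 ≤ dot v c := by linarith
  have hc3 : cross v c ^ 2 ≤ dot v c ^ 2 / 3 := by
    have := mul_nonneg hcl hcr
    nlinarith
  have hsq := dot_sq_add_cross_sq v u'
  rw [hvn, hu'n] at hsq
  have hX : dot v u' = dot v u₁ + dot v c := by rw [hu', hdadd]; ring
  have hY : cross v u' = cross v u₁ + cross v c := by rw [hu', hcadd]; ring
  have hhalf : B / 2 ≤ dot v u' := by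
    rw [hX]
    exact half_le_of_norm_eq hBpos hlow hy2 hc0 hc3 (by rw [← hX, ← hY, hsq])
  -- As `‖v‖ = ‖u'‖ = r`, the bound `hhalf` says that `u'` is within π/3 of `v`, so the rays
  -- straddle its normal.
  have hcone : cross v u' ^ 2 ≤ 3 * dot v u' ^ 2 := by
    have h1 : (B / 2) ^ 2 ≤ dot v u' ^ 2 := pow_le_pow_left₀ (by positivity) hhalf 2
    nlinarith
  have hvx : v ∈ transitions U V r (H x) :=
    hD.mem_transitions_along hr hU hV isPreconnected_univ hcont.continuousOn
      (fun y _ => hH.isCurve.mem y) (Set.mem_univ 0) (Set.mem_univ x) hH.period_mem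
  obtain ⟨e, f, hef, -, he, hf⟩ := hD.exists_dirs_eq hr hU hV (hH.isCurve.mem x) hvx
  have hce : ∀ g ∈ dirs D (H x), 0 < dot v g * dot u' g := fun g hg =>
    dot_mul_dot_pos_of_cone ((hH.central x).1 g hg) ((hH.central x).2 g hg) (by linarith) hcone
  have htrans : u' ∈ transitions U V r (H 0) := by
    refine hD.mem_transitions_of_mul_neg hu'n hr (e := e) (f := f)
      (by rw [← hHu', hu₁t x, hef]) ?_
    have h5 := pos_of_mul_pos_right (hce e (by rw [hef]; simp)) he.le
    have h6 := hce f (by rw [hef]; simp)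
    exact mul_neg_of_pos_of_neg h5 (by nlinarith)
  refine ⟨u', htrans, ?_⟩
  rw [← hc₁]
  exact (hD.cross_eq_of_add_eq_add hr hU hV hH hu₁t
    (hD.mem_translations hr hU hV hH.isCurve htrans) hHu').symm

/-- An interface cannot avoid monochromatic equilateral triangles of two different sizes. -/
theorem false_of_avoids (hD : PolygonalInterface D U V) (ha : 0 < a) (hab : a < b)
    (hUa : AvoidsEquilateral U a) (hVa : AvoidsEquilateral V a)
    (hUb : AvoidsEquilateral U b) (hVb : AvoidsEquilateral V b) (hne : D.Nonempty) : False := by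
  obtain ⟨P, hP⟩ := hne
  have hb : 0 < b := ha.trans hab
  obtain ⟨w, v, T, H, hH, rfl⟩ := hD.exists_isPeriodicCurve hb hUb hVb hP
  have hs : √3 * √3 = 3 := Real.mul_self_sqrt (by norm_num)
  have hs0 : 0 < √3 := Real.sqrt_pos.2 (by norm_num)
  have hvn : ‖v‖ = b := hH.period_mem.1
  set B := b ^ 2 with hB
  have hBpos : 0 < B := by positivity
  have hvv : dot v v = B := by rw [dot_self, hvn]
  have hcadd : ∀ y z, cross v (y + z) = cross v y + cross v z := by
    intro y z; simp [cross]; ring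
  have hcsub : ∀ y z, cross v (y - z) = cross v y - cross v z := by
    intro y z; simp [cross]; ring
  have hcom : ∀ z, cross v (om * z) = cross v z / 2 + √3 / 2 * dot v z := by
    intro z; simp [dot, cross]; ring
  have hcneg : ∀ z, cross v (-z) = -cross v z := by intro z; simp [cross]; ring
  have hcov : cross v (om * v) = √3 / 2 * B := by
    rw [hcom, hvv]; simp [cross]; ring
  have hB4 : 0 < √3 / 4 * B := by positivity
  -- a translation of small height that comes from the triangles of side `a`
  obtain ⟨u₀, hu₀, hu₀pos, hu₀le⟩ : ∃ u ∈ translations D H, 0 < cross v u ∧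
      cross v u ≤ √3 / 4 * B := by
    -- One of a color change of length `a` and its rotations by ±π/3 has nonzero height below `√3 /
    -- 2 * B`, the height of `om * v`.
    obtain ⟨g, hg, hgpos, hglt⟩ : ∃ g ∈ transitions U V a (H 0), 0 < |cross v g| ∧
        |cross v g| < √3 / 2 * B := by
      obtain ⟨g, hg⟩ := hD.transitions_nonempty ha hUa hVa hP
      have hg1 := hD.om_mul_mem_transitions ha hUa hVa hP hg
      have hg2 := hD.sub_om_mul_mem_transitions ha hUa hVa hP hg
      have hsq := dot_sq_add_cross_sq v g
      rw [hvn, hg.1] at hsq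
      have hsqpos : 0 < dot v g ^ 2 + cross v g ^ 2 := by rw [hsq]; positivity
      have hsqlt : dot v g ^ 2 + cross v g ^ 2 < B ^ 2 := by
        rw [hsq]; have : a ^ 2 < B := pow_lt_pow_left₀ hab ha.le two_ne_zero
        nlinarith
      have hxB : |dot v g| < B := abs_lt_of_sq_lt_sq (by nlinarith [sq_nonneg (cross v g)]) hBpos.le
      have hyB : |cross v g| < B := abs_lt_of_sq_lt_sq (by nlinarith [sq_nonneg (dot v g)]) hBpos.le
      by_cases h0 : cross v g = 0
      · refine ⟨om * g, hg1, ?_, ?_⟩ <;>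
          rw [hcom, h0, zero_div, zero_add, abs_mul, abs_of_pos (by positivity)]
        · have : dot v g ≠ 0 := fun h => by rw [h, h0] at hsqpos; simp at hsqpos
          have := abs_pos.2 this
          positivity
        · exact mul_lt_mul_of_pos_left hxB (by positivity)
      · by_cases h1 : |cross v g| < √3 / 2 * B
        · exact ⟨g, hg, abs_pos.2 h0, h1⟩
        · push Not at h1
          have h2 : 3 / 4 * B ^ 2 ≤ cross v g ^ 2 := by
            have h3 := pow_le_pow_left₀ (by positivity) h1 2
            rw [sq_abs] at h3
            have h4 : (√3 / 2 * B) ^ 2 = (√3 * √3) / 4 * B ^ 2 := by ring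
            rwa [h4, hs] at h3
          -- Here `g` is nearly orthogonal to `v`. The rotation that turns it towards the line of
          -- `v` has absolute height `|cross v g| / 2 - √3 / 2 * |dot v g|`, which is positive and
          -- below `B / 2`.
          have h3 : |√3 / 2 * dot v g| < |cross v g / 2| := by
            apply sq_lt_sq.1
            have : (√3 / 2 * dot v g) ^ 2 = (√3 * √3) / 4 * dot v g ^ 2 := by ring
            rw [this, hs]; nlinarith
          have h4 : |cross v g / 2| = |cross v g| / 2 := by rw [abs_div, abs_two]
          have hs1 : B / 2 < √3 / 2 * B := by
            have : 1 < √3 := by nlinarith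
            have := mul_lt_mul_of_pos_right this hBpos
            linarith
          have e2 : cross v (g - om * g) = cross v g / 2 - √3 / 2 * dot v g := by
            rw [hcsub, hcom]; ring
          rw [h4, abs_lt] at h3
          rcases le_total 0 (cross v g) with hy | hy <;>
            rcases le_total 0 (√3 / 2 * dot v g) with hx | hx
          · rw [abs_of_nonneg hy] at h3 hyB
            refine ⟨g - om * g, hg2, ?_, ?_⟩ <;> rw [e2, abs_of_pos (by linarith)] <;> linarith
          · rw [abs_of_nonneg hy] at h3 hyB
            refine ⟨om * g, hg1, ?_, ?_⟩ <;> rw [hcom, abs_of_pos (by linarith)] <;> linarith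
          · rw [abs_of_nonpos hy] at h3 hyB
            refine ⟨om * g, hg1, ?_, ?_⟩ <;> rw [hcom, abs_of_neg (by linarith)] <;> linarith
          · rw [abs_of_nonpos hy] at h3 hyB
            refine ⟨g - om * g, hg2, ?_, ?_⟩ <;> rw [e2, abs_of_neg (by linarith)] <;> linarith
    have hneg := hD.neg_mem_transitions ha hUa hVa hP hg
    obtain ⟨k, hk, hkneg, hkpos, hklt⟩ : ∃ k ∈ transitions U V a (H 0),
        -k ∈ transitions U V a (H 0) ∧ 0 < cross v k ∧ cross v k < √3 / 2 * B := by
      rcases le_total 0 (cross v g) with hy | hy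
      · rw [abs_of_nonneg hy] at hgpos hglt
        exact ⟨g, hg, hneg, hgpos, hglt⟩
      · rw [abs_of_nonpos hy] at hgpos hglt
        exact ⟨-g, hneg, by rwa [neg_neg], by rwa [hcneg], by rwa [hcneg]⟩
    -- A height above half that of `om * v` is replaced by its complement, the height of `om * v -
    -- k`.
    by_cases h : cross v k ≤ √3 / 4 * B
    · exact ⟨k, hD.mem_translations ha hUa hVa hH.isCurve hk, hkpos, h⟩
    · have := (hD.add_mem_translations hb hUb hVb hH
        (hD.mem_translations ha hUa hVa hH.isCurve hkneg)).2.2.1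
      refine ⟨_, this, ?_, ?_⟩ <;> rw [hcadd, hcneg, hcov] <;> linarith
  set M := {u | u ∈ transitions U V b (H 0) ∧ 0 < cross v u ∧ cross v u ≤ √3 / 4 * B} with hM
  have hMfin : M.Finite := (hD.finite_transitions hb (H 0)).subset fun u hu => hu.1
  have hMne : M.Nonempty := by
    obtain ⟨u, hu, h⟩ := hD.exists_transition_of_translation hb hUb hVb hH hu₀ hu₀pos hu₀le
    exact ⟨u, hu, by rwa [h], by rwa [h]⟩
  obtain ⟨u, ⟨hu, hupos, hule⟩, hmin⟩ := Set.exists_min_image M (cross v) hMfin hMne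
  -- a translation of even smaller height
  have descend : ∀ k ∈ translations D H, 0 < cross v k → cross v k < cross v u → False := by
    intro k hk h1 h2
    obtain ⟨k', hk', h⟩ := hD.exists_transition_of_translation hb hUb hVb hH hk h1
      (h2.le.trans hule)
    have := hmin k' ⟨hk', by rwa [h], by rw [h]; exact h2.le.trans hule⟩
    rw [h] at this
    linarith
  have hsq := dot_sq_add_cross_sq v u
  rw [hvn, hu.1] at hsq
  -- The rotation, by π/3 or by -π/3, is the one that turns `u` towards the normal of `v` on the
  -- side of positive height.
  rcases le_total 0 (dot v u) with h | h
  · obtain ⟨h1, h2⟩ := height_descent (x := dot v u) hupos hule hsq hBpos h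
    have hk := (hD.add_mem_translations hb hUb hVb hH (hD.mem_translations hb hUb hVb hH.isCurve
      (hD.om_mul_mem_transitions hb hUb hVb hP hu))).2.2.2
    have e : cross v (om * u - om * v) = cross v u / 2 + √3 / 2 * dot v u - √3 / 2 * B := by
      rw [hcsub, hcov, hcom]
    exact descend _ hk (by rwa [e]) (by rwa [e])
  · obtain ⟨h1, h2⟩ := height_descent (x := -dot v u) hupos hule (by rw [neg_sq, hsq]) hBpos
      (by linarith)
    have hk := (hD.add_mem_translations hb hUb hVb hH (hD.mem_translations hb hUb hVb hH.isCurve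
      (hD.sub_om_mul_mem_transitions hb hUb hVb hP hu))).2.2.2
    have e : cross v (u - om * u - om * v) =
        cross v u / 2 + √3 / 2 * -dot v u - √3 / 2 * B := by
      rw [hcsub, hcsub, hcov, hcom]; ring
    exact descend _ hk (by rwa [e]) (by rwa [e])

end PolygonalInterface

/-! ### From arbitrary triangles to equilateral ones -/

namespace PolygonalInterface

variable {D U V : Set ℂ}

/-- `D` has empty interior, so each condition can be met in turn by shrinking the open set. -/
theorem exists_mem_forall_add_not_mem (hD : PolygonalInterface D U V) (l : List ℂ) :
    ∀ W : Set ℂ, IsOpen W → W.Nonempty → ∃ Q ∈ W, ∀ c ∈ l, Q + c ∉ D := by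
  induction l with
  | nil => exact fun W _ hne => ⟨hne.some, hne.some_mem, by simp⟩
  | cons c l ih =>
    intro W hW hne
    have hopen : IsOpen {Q : ℂ | Q + c ∉ D} :=
      hD.isClosed.isOpen_compl.preimage (by fun_prop : Continuous fun Q : ℂ => Q + c)
    have hne' : (W ∩ {Q | Q + c ∉ D}).Nonempty := by
      obtain ⟨Q, hQ⟩ := hne
      by_cases h : Q + c ∈ D
      · have hW' : IsOpen {z : ℂ | z - c ∈ W} := hW.preimage (by fun_prop)
        obtain ⟨z, hz, hzU⟩ := mem_closure_iff.1 (hD.subset_closure_left h) _ hW'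
          (by simpa using hQ)
        exact ⟨z - c, hz, fun h' => hD.not_mem_left (by simpa using h') hzU⟩
      · exact ⟨Q, hQ, h⟩
    obtain ⟨Q, ⟨hQ, hQc⟩, hQl⟩ := ih _ (hW.inter hopen) hne'
    refine ⟨Q, hQ, fun c' hc' => ?_⟩
    rcases List.mem_cons.1 hc' with rfl | hc'
    · exact hQc
    · exact hQl c' hc'

/-- If no copy of a triangle is monochromatic, then neither is an equilateral triangle with the
same side. -/
theorem avoidsEquilateral (hD : PolygonalInterface D U V) {r : ℝ} {τ : ℂ}
    (hU : ∀ q s : ℂ, ‖s‖ = r → q ∈ U → q + s ∈ U → q + s * τ ∈ U → False)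
    (hV : ∀ q s : ℂ, ‖s‖ = r → q ∈ V → q + s ∈ V → q + s * τ ∈ V → False) :
    AvoidsEquilateral U r := by
  intro P s hs h0 h1 h2
  have hW : IsOpen {Q : ℂ | Q ∈ U ∧ Q + s ∈ U ∧ Q + om * s ∈ U} :=
    hD.isOpen_left.inter ((hD.isOpen_left.preimage (by fun_prop)).inter
      (hD.isOpen_left.preimage (by fun_prop)))
  -- The equilateral triangle is moved slightly so that the five auxiliary points avoid `D`. Each of
  -- them completes a triangle of the given shape on two points of known color, which forces the
  -- colors `c1` to `c5`; then `c4`, `c5` and `Q + om * s` form a copy in `U`.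
  obtain ⟨Q, ⟨hQ0, hQ1, hQ2⟩, hQ⟩ := hD.exists_mem_forall_add_not_mem
    [s - s * τ, om * s - om * s * τ, s + (om - 1) * s * τ, om * s - s * τ,
      (1 + om) * s - s * τ] _ hW ⟨P, h0, h1, h2⟩
  simp only [List.mem_cons, List.not_mem_nil, or_false, forall_eq_or_imp, forall_eq] at hQ
  obtain ⟨n1, n2, n3, n4, n5⟩ := hQ
  have k1 : ‖om * s‖ = r := by rw [norm_mul, norm_om, one_mul, hs]
  have k2 : ‖(om - 1) * s‖ = r := by rw [← om_sq, norm_mul, norm_mul, norm_om, hs]; ring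
  have k3 : ‖(1 - om) * s‖ = r := by
    rw [← k2, ← norm_neg ((om - 1) * s)]; congr 1; ring
  have c1 : Q + (s - s * τ) ∈ V := (hD.mem_or_mem n1).resolve_left fun h =>
    hU (Q + s) (-s) (by rw [norm_neg, hs]) hQ1 (by simpa using hQ0) (by convert h using 1; ring)
  have c2 : Q + (om * s - om * s * τ) ∈ V := (hD.mem_or_mem n2).resolve_left fun h =>
    hU (Q + om * s) (-(om * s)) (by rw [norm_neg, k1]) hQ2 (by simpa using hQ0)
      (by convert h using 1; ring)
  have c3 : Q + (s + (om - 1) * s * τ) ∈ V := (hD.mem_or_mem n3).resolve_left fun h =>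
    hU (Q + s) ((om - 1) * s) k2 hQ1 (by convert hQ2 using 1; ring) (by convert h using 1; ring)
  have c4 : Q + (om * s - s * τ) ∈ U := (hD.mem_or_mem n4).resolve_right fun h =>
    hV (Q + (om * s - s * τ)) ((1 - om) * s) k3 h (by convert c1 using 1; ring)
      (by convert c2 using 1; ring)
  have c5 : Q + ((1 + om) * s - s * τ) ∈ U := (hD.mem_or_mem n5).resolve_right fun h =>
    hV (Q + (s - s * τ)) (om * s) k1 c1 (by convert h using 1; ring) (by convert c3 using 1; ring)
  exact hU (Q + (om * s - s * τ)) s hs c4 (by convert c5 using 1; ring)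
    (by convert hQ2 using 1; ring)

end PolygonalInterface

/-! ### Polygonal colorings give interfaces -/

/-- `s` is a closed segment, half-line or line with unit direction `d`. -/
def IsSegmentAlong (d : ℂ) (s : Set ℂ) : Prop :=
  ‖d‖ = 1 ∧ ∃ (a : ℂ) (I : Set ℝ), IsClosed I ∧ I.OrdConnected ∧ I.Nontrivial ∧
    s = (fun t : ℝ => a + t * d) '' I

namespace IsSegmentAlong

variable {d : ℂ} {s : Set ℂ}

theorem isClosed (h : IsSegmentAlong d s) : IsClosed s := by
  obtain ⟨hd, a, I, hI, -, -, rfl⟩ := h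
  have : Isometry fun t : ℝ => a + t * d := Isometry.of_dist_eq fun x y => by
    rw [dist_eq_norm, dist_eq_norm, add_sub_add_left_eq_sub, ← sub_mul, norm_mul, hd, mul_one,
      ← Complex.ofReal_sub, Complex.norm_real]
  exact this.isClosedEmbedding.isClosedMap _ hI

theorem eq_or_eq_neg (h : IsSegmentAlong d s) {P e : ℂ} (he : ‖e‖ = 1) {t t' : ℝ} (hne : t ≠ t')
    (h1 : P + t * e ∈ s) (h2 : P + t' * e ∈ s) : e = d ∨ e = -d := by
  obtain ⟨hd, a, I, -, -, -, rfl⟩ := h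
  obtain ⟨x, -, hx⟩ := h1
  obtain ⟨y, -, hy⟩ := h2
  apply eq_or_eq_neg_of_cross_eq_zero hd he
  have h3 : ((t - t' : ℝ) : ℂ) * e = ((x - y : ℝ) : ℂ) * d := by
    push_cast; linear_combination hy - hx
  have h4 := congrArg (cross d) h3
  have h5 : cross d d = 0 := by simp [cross]; ring
  rw [cross_real_mul, cross_real_mul, h5, mul_zero] at h4
  exact (mul_eq_zero.1 h4).resolve_left (sub_ne_zero.2 hne)

/-- One radius serves all directions: from a point of `s` only `d` and `-d` can stay in `s`, and off
`s` a whole disc misses it. -/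
theorem conic (h : IsSegmentAlong d s) (P : ℂ) : ∃ ε > 0, ∀ e : ℂ, ‖e‖ = 1 →
    (∀ t : ℝ, 0 < t → t < ε → P + t * e ∈ s) ∨ (∀ t : ℝ, 0 < t → t < ε → P + t * e ∉ s) := by
  by_cases hP : P ∈ s
  · have h' := h
    obtain ⟨hd, a, I, hI, hI', -, rfl⟩ := h
    have hd0 : d ≠ 0 := fun h0 => by simp [h0] at hd
    obtain ⟨t₀, ht₀, rfl⟩ := hP
    have hmem : ∀ t : ℝ, a + t * d ∈ (fun t : ℝ => a + t * d) '' I ↔ t ∈ I := by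
      refine fun t => ⟨?_, fun ht => ⟨t, ht, rfl⟩⟩
      rintro ⟨x, hx, hxt⟩
      have : (x : ℂ) = t := mul_right_cancel₀ hd0 (add_left_cancel hxt)
      rwa [← Complex.ofReal_inj.1 this]
    have ray : ∀ σ : ℝ, ∃ ε > 0, (∀ t : ℝ, 0 < t → t < ε → t₀ + σ * t ∈ I) ∨
        (∀ t : ℝ, 0 < t → t < ε → t₀ + σ * t ∉ I) := by
      intro σ
      -- If `I` has any point on this side of `t₀`, order-connectedness fills the gap; otherwise
      -- every radius works.
      by_cases hex : ∃ δ > 0, t₀ + σ * δ ∈ I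
      · obtain ⟨δ, hδ, hδI⟩ := hex
        refine ⟨δ, hδ, Or.inl fun t ht htδ => ?_⟩
        rcases le_total 0 σ with hσ | hσ
        · exact hI'.out ht₀ hδI ⟨by nlinarith, by nlinarith⟩
        · exact hI'.out hδI ht₀ ⟨by nlinarith, by nlinarith⟩
      · push Not at hex
        exact ⟨1, one_pos, Or.inr fun t ht _ => hex t ht⟩
    obtain ⟨ε₁, hε₁, h1⟩ := ray 1
    obtain ⟨ε₂, hε₂, h2⟩ := ray (-1)
    refine ⟨min ε₁ ε₂, lt_min hε₁ hε₂, fun e he => ?_⟩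
    have e1 : ∀ t : ℝ, a + t₀ * d + t * d = a + ((t₀ + 1 * t : ℝ) : ℂ) * d := by
      intro t; push_cast; ring
    have e2 : ∀ t : ℝ, a + t₀ * d + t * -d = a + ((t₀ + -1 * t : ℝ) : ℂ) * d := by
      intro t; push_cast; ring
    by_cases hed : e = d
    · rw [hed]
      simp only [e1, hmem]
      exact h1.imp (fun h t ht ht' => h t ht (ht'.trans_le (min_le_left _ _)))
        (fun h t ht ht' => h t ht (ht'.trans_le (min_le_left _ _)))
    by_cases hed' : e = -d
    · rw [hed']
      simp only [e2, hmem]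
      exact h2.imp (fun h t ht ht' => h t ht (ht'.trans_le (min_le_right _ _)))
        (fun h t ht ht' => h t ht (ht'.trans_le (min_le_right _ _)))
    · right
      intro t ht _ hmem'
      rcases h'.eq_or_eq_neg he ht.ne' hmem' (t' := 0) ⟨t₀, ht₀, by simp⟩ with h | h
      · exact hed h
      · exact hed' h
  · obtain ⟨ε, hε, hsub⟩ := Metric.isOpen_iff.1 h.isClosed.isOpen_compl P hP
    refine ⟨ε, hε, fun e he => Or.inr fun t ht htε hmem => ?_⟩
    refine hsub (?_ : P + t * e ∈ Metric.ball P ε) hmem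
    rw [Metric.mem_ball, dist_eq_norm, add_sub_cancel_left, norm_mul, he, mul_one,
      Complex.norm_real, Real.norm_of_nonneg ht.le]
    exact htε

theorem exists_ray (h : IsSegmentAlong d s) {P : ℂ} (hP : P ∈ s) : ∃ e : ℂ, ‖e‖ = 1 ∧
    ∃ ε > 0, ∀ t : ℝ, 0 < t → t < ε → P + t * e ∈ s := by
  obtain ⟨hd, a, I, hI, hI', hI2, rfl⟩ := h
  obtain ⟨t₀, ht₀, rfl⟩ := hP
  obtain ⟨t₁, ht₁, hne⟩ := hI2.exists_ne t₀
  rcases lt_or_gt_of_ne hne with hlt | hlt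
  · refine ⟨-d, by rwa [norm_neg], t₀ - t₁, by linarith, fun t ht htε => ?_⟩
    exact ⟨t₀ - t, hI'.out ht₁ ht₀ ⟨by linarith, by linarith⟩, by push_cast; ring⟩
  · refine ⟨d, hd, t₁ - t₀, by linarith, fun t ht htε => ?_⟩
    exact ⟨t₀ + t, hI'.out ht₀ ht₁ ⟨by linarith, by linarith⟩, by push_cast; ring⟩

theorem finite_inter_sphere (h : IsSegmentAlong d s) (P : ℂ) (r : ℝ) :
    (s ∩ Metric.sphere P r).Finite := by
  obtain ⟨hd, a, I, -, -, -, rfl⟩ := h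
  set β := dot (a - P) d with hβ
  set c := r ^ 2 - ‖a - P‖ ^ 2 + β ^ 2 with hc
  have hfin : ({-β + √c, -β - √c} : Set ℝ).Finite := Set.toFinite _
  refine (hfin.image fun t : ℝ => a + t * d).subset ?_
  rintro _ ⟨⟨t, -, rfl⟩, ht⟩
  refine ⟨t, ?_, rfl⟩
  have h1 : a + t * d - P = (a - P) + t * d := by ring
  rw [mem_sphere_iff_norm, h1] at ht
  have h2 := norm_sq_add (a - P) (t * d)
  rw [ht, dot_real_mul, norm_mul, hd, mul_one, Complex.norm_real, Real.norm_eq_abs, sq_abs] at h2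
  have h3 : (t + β) ^ 2 = c := by rw [hc]; linarith
  have h4 : 0 ≤ c := h3 ▸ sq_nonneg _
  have h5 : √c ^ 2 = c := Real.sq_sqrt h4
  rcases sq_eq_sq_iff_eq_or_eq_neg.1 (h3.trans h5.symm) with h6 | h6
  · left; linarith
  · right; rw [Set.mem_singleton_iff]; linarith

end IsSegmentAlong

theorem StraightSegment.exists_isSegmentAlong (s : StraightSegment) :
    ∃ d, IsSegmentAlong d s.carrier := by
  have hunit : ∀ d : ℂ, d ≠ 0 → ‖d / (‖d‖ : ℝ)‖ = 1 := fun d hd => by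
    rw [norm_div, Complex.norm_real, norm_norm, div_self (norm_ne_zero_iff.2 hd)]
  have hmul : ∀ d : ℂ, d ≠ 0 → ∀ t : ℝ, ((t * ‖d‖ : ℝ) : ℂ) * (d / (‖d‖ : ℝ)) = t * d := by
    intro d hd t
    have : (‖d‖ : ℂ) ≠ 0 := by simpa using hd
    push_cast; field_simp
  have hmul' : ∀ d : ℂ, ∀ t : ℝ, ((t / ‖d‖ : ℝ) : ℂ) * d = t * (d / (‖d‖ : ℝ)) := by
    intro d t; push_cast; ring
  cases s with
  | bounded a b h =>
    have hd : b - a ≠ 0 := sub_ne_zero.2 h.symm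
    have hpos : 0 < ‖b - a‖ := norm_pos_iff.2 hd
    refine ⟨(b - a) / (‖b - a‖ : ℝ), hunit _ hd, a, Set.Icc 0 ‖b - a‖, isClosed_Icc,
      Set.ordConnected_Icc, ⟨0, ⟨le_rfl, hpos.le⟩, ‖b - a‖, ⟨hpos.le, le_rfl⟩, hpos.ne⟩, ?_⟩
    simp only [carrier, segment_eq_image']
    ext z
    constructor
    · rintro ⟨t, ⟨ht0, ht1⟩, rfl⟩
      refine ⟨t * ‖b - a‖, ⟨by positivity, by nlinarith⟩, ?_⟩
      simp only [hmul _ hd, Complex.real_smul]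
    · rintro ⟨t, ⟨ht0, ht1⟩, rfl⟩
      refine ⟨t / ‖b - a‖, ⟨by positivity, (div_le_one hpos).2 ht1⟩, ?_⟩
      simp only [Complex.real_smul, hmul']
  | halfLine a d hd =>
    have hpos : 0 < ‖d‖ := norm_pos_iff.2 hd
    refine ⟨d / (‖d‖ : ℝ), hunit _ hd, a, Set.Ici 0, isClosed_Ici, Set.ordConnected_Ici,
      ⟨0, by simp, 1, by simp, zero_ne_one⟩, ?_⟩
    ext z
    constructor
    · rintro ⟨t, ht, rfl⟩
      exact ⟨t * ‖d‖, mul_nonneg ht hpos.le, by simp only [hmul _ hd]⟩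
    · rintro ⟨t, ht, rfl⟩
      exact ⟨t / ‖d‖, div_nonneg ht hpos.le, by simp only [hmul']⟩
  | line a d hd =>
    refine ⟨d / (‖d‖ : ℝ), hunit _ hd, a, Set.univ, isClosed_univ, Set.ordConnected_univ,
      ⟨0, by simp, 1, by simp, zero_ne_one⟩, ?_⟩
    ext z
    constructor
    · rintro ⟨t, rfl⟩
      exact ⟨t * ‖d‖, Set.mem_univ _, by simp only [hmul _ hd]⟩
    · rintro ⟨t, -, rfl⟩
      exact ⟨t / ‖d‖, by simp only [hmul']⟩

/-- The boundary of a polygonal coloring, together with the interiors of its two classes. -/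
theorem PlaneColoring.IsPolygonal.polygonalInterface {χ : PlaneColoring} (hχ : χ.IsPolygonal) :
    PolygonalInterface χ.boundary (interior χ.black) (interior χ.white) := by
  obtain ⟨hblack, hwhite, S, hS, -, hfin⟩ := hχ
  have hmem : ∀ z, z ∈ χ.boundary ↔ ∃ s ∈ S, z ∈ s.carrier := by
    intro z; rw [hS]; simp
  -- the segments that meet the unit disc around `P`, with a common radius
  have hlocal : ∀ P : ℂ, ∃ F : Set StraightSegment, F.Finite ∧ F ⊆ S ∧ ∃ ε > 0,
      (∀ (e : ℂ) (t : ℝ), ‖e‖ = 1 → 0 < t → t < ε → P + t * e ∈ χ.boundary →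
        ∃ s ∈ F, ∀ t : ℝ, 0 < t → t < ε → P + t * e ∈ s.carrier) := by
    intro P
    have hF := hfin (Metric.ball P 1) Metric.isBounded_ball
    set F := {s ∈ S | (s.carrier ∩ Metric.ball P 1).Nonempty} with hFdef
    have hrad : ∀ G : Set StraightSegment, G.Finite → ∃ ε > 0, ∀ s ∈ G, ∀ e : ℂ, ‖e‖ = 1 →
        (∀ t : ℝ, 0 < t → t < ε → P + t * e ∈ s.carrier) ∨
        (∀ t : ℝ, 0 < t → t < ε → P + t * e ∉ s.carrier) := by
      intro G hG
      induction G, hG using Set.Finite.induction_on with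
      | empty => exact ⟨1, one_pos, by simp⟩
      | insert _ _ ih =>
        rename_i s G _ _
        obtain ⟨ε, hε, h⟩ := ih
        obtain ⟨d, hd⟩ := s.exists_isSegmentAlong
        obtain ⟨ε', hε', h'⟩ := hd.conic P
        refine ⟨min ε ε', lt_min hε hε', ?_⟩
        rintro s' (rfl | hs') e he
        · exact (h' e he).imp (fun h t ht ht' => h t ht (ht'.trans_le (min_le_right _ _)))
            (fun h t ht ht' => h t ht (ht'.trans_le (min_le_right _ _)))
        · exact (h s' hs' e he).imp (fun h t ht ht' => h t ht (ht'.trans_le (min_le_left _ _)))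
            (fun h t ht ht' => h t ht (ht'.trans_le (min_le_left _ _)))
    obtain ⟨ε, hε, h⟩ := hrad F hF
    refine ⟨F, hF, fun s hs => hs.1, min ε 1, lt_min hε one_pos, fun e t he ht htε hbd => ?_⟩
    obtain ⟨s, hs, hts⟩ := (hmem _).1 hbd
    have hsF : s ∈ F := by
      refine ⟨hs, _, hts, ?_⟩
      rw [Metric.mem_ball, dist_eq_norm, add_sub_cancel_left, norm_mul, he, mul_one,
        Complex.norm_real, Real.norm_of_nonneg ht.le]
      exact htε.trans_le (min_le_right _ _)
    refine ⟨s, hsF, fun t' ht' htε' => ?_⟩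
    refine (h s hsF e he).resolve_right (fun h' => h' t ht (htε.trans_le (min_le_left _ _)) hts)
      t' ht' (htε'.trans_le (min_le_left _ _))
  have hsmall : ∀ {P e : ℂ}, e ∈ dirs χ.boundary P → ∀ ε > 0, ∃ t : ℝ, 0 < t ∧ t < ε ∧
      P + t * e ∈ χ.boundary := by
    rintro P e ⟨-, δ, hδ, h⟩ ε hε
    have hm : 0 < min δ ε := lt_min hδ hε
    refine ⟨min δ ε / 2, by positivity, ?_, h _ (by positivity) ?_⟩
    · linarith [min_le_right δ ε]
    · linarith [min_le_left δ ε]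
  refine ⟨isOpen_interior, isOpen_interior, ?_, ?_, ?_, ?_, ?_, ?_, ?_, ?_⟩
  · exact χ.isCompl.disjoint.mono interior_subset interior_subset
  · rw [PlaneColoring.boundary, compl_frontier_eq_union_interior, χ.isCompl.compl_eq]
  · exact frontier_subset_closure.trans (closure_minimal hblack isClosed_closure)
  · rw [χ.boundary_eq_frontier_white]
    exact frontier_subset_closure.trans (closure_minimal hwhite isClosed_closure)
  · intro P
    obtain ⟨F, hF, -, ε, hε, h⟩ := hlocal P
    choose d hd using StraightSegment.exists_isSegmentAlong
    refine (hF.biUnion fun s _ => (Set.toFinite {d s, -d s})).subset fun e he => ?_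
    obtain ⟨t, ht, htε, hbd⟩ := hsmall he ε hε
    obtain ⟨s, hs, hall⟩ := h e t he.1 ht htε hbd
    refine Set.mem_biUnion hs ?_
    exact (hd s).eq_or_eq_neg he.1 (by linarith : t ≠ t / 2) (hall t ht htε)
      (hall (t / 2) (by linarith) (by linarith))
  · intro P hP
    obtain ⟨s, hs, hPs⟩ := (hmem P).1 hP
    obtain ⟨d, hd⟩ := s.exists_isSegmentAlong
    obtain ⟨e, he, ε, hε, h⟩ := hd.exists_ray hPs
    exact ⟨e, he, ε, hε, fun t ht htε => (hmem _).2 ⟨s, hs, h t ht htε⟩⟩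
  · intro P
    obtain ⟨F, hF, hFS, ε, hε, h⟩ := hlocal P
    refine ⟨ε, hε, fun e t he ht htε => ⟨fun hbd => ?_, fun hed => ?_⟩⟩
    · obtain ⟨s, hs, hall⟩ := h e t he ht htε hbd
      exact ⟨he, ε, hε, fun t ht htε => (hmem _).2 ⟨s, hFS hs, hall t ht htε⟩⟩
    · obtain ⟨t', ht', htε', hbd⟩ := hsmall hed ε hε
      obtain ⟨s, hs, hall⟩ := h e t' he ht' htε' hbd
      exact (hmem _).2 ⟨s, hFS hs, hall t ht htε⟩
  · intro P r hr
    have hF := hfin (Metric.sphere P r) Metric.isBounded_sphere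
    refine (hF.biUnion fun s _ => ?_ : (⋃ s ∈ {s ∈ S | (s.carrier ∩ Metric.sphere P r).Nonempty},
      s.carrier ∩ Metric.sphere P r).Finite).subset ?_
    · obtain ⟨d, hd⟩ := s.exists_isSegmentAlong
      exact hd.finite_inter_sphere P r
    · rintro z ⟨hz, hzr⟩
      obtain ⟨s, hs, hzs⟩ := (hmem z).1 hz
      exact Set.mem_biUnion (show s ∈ {s ∈ S | (s.carrier ∩ Metric.sphere P r).Nonempty} from
        ⟨hs, z, hzs, hzr⟩) ⟨hzs, hzr⟩

/-! ### Conclusion -/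

theorem theorem5 (X Y Z : Plane) (hT : IsTriangle X Y Z) (hne : ¬ IsEquilateral X Y Z)
    (χ : PlaneColoring) (hχ : χ.IsPolygonal) :
    ∃ X' Y' Z' : Plane, IsCopy {X', Y', Z'} {X, Y, Z} ∧ χ.Monochromatic {X', Y', Z'} ∧
      X' ∉ χ.boundary ∧ Y' ∉ χ.boundary ∧ Z' ∉ χ.boundary := by
  have hD := hχ.polygonalInterface
  have hcopy : ∀ u v : ℂ, ‖u‖ = 1 → IsCopy {u * X + v, u * Y + v, u * Z + v} {X, Y, Z} :=
    fun u v hu => ⟨u, v, hu, by rw [Set.image_insert_eq, Set.image_pair]⟩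
  by_contra hcon
  have hU : ∀ u v : ℂ, ‖u‖ = 1 → u * X + v ∈ interior χ.black → u * Y + v ∈ interior χ.black →
      u * Z + v ∈ interior χ.black → False := by
    intro u v hu h1 h2 h3
    refine hcon ⟨_, _, _, hcopy u v hu, Or.inl ?_,
      fun h => hD.not_mem_left h h1, fun h => hD.not_mem_left h h2, fun h => hD.not_mem_left h h3⟩
    rintro z (rfl | rfl | rfl)
    exacts [interior_subset h1, interior_subset h2, interior_subset h3]
  have hV : ∀ u v : ℂ, ‖u‖ = 1 → u * X + v ∈ interior χ.white → u * Y + v ∈ interior χ.white →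
      u * Z + v ∈ interior χ.white → False := by
    intro u v hu h1 h2 h3
    refine hcon ⟨_, _, _, hcopy u v hu, Or.inr ?_,
      fun h => hD.not_mem_right h h1, fun h => hD.not_mem_right h h2,
      fun h => hD.not_mem_right h h3⟩
    rintro z (rfl | rfl | rfl)
    exacts [interior_subset h1, interior_subset h2, interior_subset h3]
  -- With empty boundary the connected plane has one color, and the triangle itself is
  -- monochromatic.
  have hnonempty : χ.boundary.Nonempty := by
    by_contra hempty
    rw [Set.not_nonempty_iff_eq_empty] at hempty
    rcases hD.subset_or_subset (isPreconnected_univ) (fun z _ => by simp [hempty]) with h | h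
    · exact hU 1 0 (by simp) (h trivial) (h trivial) (h trivial)
    · exact hV 1 0 (by simp) (h trivial) (h trivial) (h trivial)
  -- The shape of the triangle on the base `A`, `B` is encoded by the complex ratio `(C - A) / (B -
  -- A)`, so oriented copies are given by the image `s` of the base vector.
  have hsim : ∀ {A B C : ℂ} {W : Set ℂ}, A ≠ B →
      (∀ u v : ℂ, ‖u‖ = 1 → u * A + v ∈ W → u * B + v ∈ W → u * C + v ∈ W → False) →
      ∀ q s : ℂ, ‖s‖ = dist A B → q ∈ W → q + s ∈ W → q + s * ((C - A) / (B - A)) ∈ W →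
        False := by
    intro A B C W hAB h q s hs h1 h2 h3
    have hBA : B - A ≠ 0 := sub_ne_zero.2 hAB.symm
    refine h (s / (B - A)) (q - s / (B - A) * A) ?_ ?_ ?_ ?_
    · rw [norm_div, hs, dist_comm, dist_eq_norm, div_self (norm_ne_zero_iff.2 hBA)]
    · convert h1 using 1; ring
    · convert h2 using 1; field_simp; ring
    · convert h3 using 1; field_simp; ring
  have havoid : ∀ {A B C : ℂ}, A ≠ B →
      (∀ u v : ℂ, ‖u‖ = 1 → u * A + v ∈ interior χ.black → u * B + v ∈ interior χ.black →
        u * C + v ∈ interior χ.black → False) →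
      (∀ u v : ℂ, ‖u‖ = 1 → u * A + v ∈ interior χ.white → u * B + v ∈ interior χ.white →
        u * C + v ∈ interior χ.white → False) →
      AvoidsEquilateral (interior χ.black) (dist A B) ∧
        AvoidsEquilateral (interior χ.white) (dist A B) := fun hAB h1 h2 =>
    ⟨hD.avoidsEquilateral (hsim hAB h1) (hsim hAB h2),
      hD.symm.avoidsEquilateral (hsim hAB h2) (hsim hAB h1)⟩
  obtain ⟨hXY, hYZ, hZX⟩ := hT
  have a1 := havoid hXY hU hV
  have a2 := havoid hYZ (fun u v hu h1 h2 h3 => hU u v hu h3 h1 h2)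
    (fun u v hu h1 h2 h3 => hV u v hu h3 h1 h2)
  have a3 := havoid hZX (fun u v hu h1 h2 h3 => hU u v hu h2 h3 h1)
    (fun u v hu h1 h2 h3 => hV u v hu h2 h3 h1)
  have hdiff : ∀ {a b : ℝ}, 0 < a → 0 < b → a ≠ b →
      AvoidsEquilateral (interior χ.black) a ∧ AvoidsEquilateral (interior χ.white) a →
      AvoidsEquilateral (interior χ.black) b ∧ AvoidsEquilateral (interior χ.white) b →
      False := by
    intro a b ha hb hab h1 h2
    rcases lt_or_gt_of_ne hab with h | h
    · exact hD.false_of_avoids ha h h1.1 h1.2 h2.1 h2.2 hnonempty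
    · exact hD.false_of_avoids hb h h2.1 h2.2 h1.1 h1.2 hnonempty
  have p1 : 0 < dist X Y := dist_pos.2 hXY
  have p2 : 0 < dist Y Z := dist_pos.2 hYZ
  have p3 : 0 < dist Z X := dist_pos.2 hZX
  by_cases h : dist X Y = dist Y Z
  · exact hdiff p2 p3 (fun h' => hne ⟨h, h'⟩) a2 a3
  · exact hdiff p1 p2 h a1 a2
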